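/- Let $\mathbb C_0=\{s\in\mathbb C:\operatorname{Re}s>0\}$. Let $\mathscr A(\mathbb C_0)$ be the Banach algebra, with the supremum norm on $\mathbb C_0$, of all functions on $\mathbb C_0$ that are uniform limits on $\mathbb C_0$ of sequences of Dirichlet polynomials $\sum_{n=1}^N a_n n^{-s}$; each such function is represented, in some half-plane, by a unique Dirichlet series $\sum_{n\ge1}a_n n^{-s}$. Let $\mathscr M$ be the set of those $D\in\mathscr A(\mathbb C_0)$ whose Dirichlet series has abscissa of absolute convergence $\sigma_a(D)$ exactly $\tfrac12$. Algebras generated by a set are not required to contain the constant function $1$: the algebra generated by $S$ consists of all values $Q(D_1,\dots,D_k)$ with $D_1,\dots,D_k\in S$ and $Q$ a complex polynomial with zero constant term. Then: 1. $\mathscr M$ is strongly $\aleph_0$-algebrable in $\mathscr A(\mathbb C_0)$: there is a countably infinite, algebraically independent (over $\mathbb C$) set $S\subset\mathscr A(\mathbb C_0)$ such that the algebra generated by $S$ is contained in $\mathscr M\cup\{0\}$. 2. There is a dense $G_\delta$ subset $G$ of $\mathscr A(\mathbb C_0)$ such that every $D\in G$ generates a free algebra contained in $\mathscr M\cup\{0\}$;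 that is, $Q(D)\neq0$ for every nonzero complex polynomial $Q$ in one variable, and $Q(D)\in\mathscr M\cup\{0\}$ for every complex polynomial $Q$ with zero constant term. -/

import Mathlib

open Filter Topology
open scoped BoundedContinuousFunction

/-- The open right half plane `ℂ₀`. -/
def rightHalfPlane : Set ℂ := {s : ℂ | 0 < s.re}

/-- The finite sum `∑_{n=1}^N a_n n^{-s}`; the value `a 0` plays no role. -/
noncomputable def dirichletPartialSum (a : ℕ → ℂ) (N : ℕ) (s : ℂ) : ℂ :=
  ∑ n ∈ Finset.Icc 1 N, a n * (n : ℂ) ^ (-s)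

/-- A bounded continuous function on `ℂ₀` is a Dirichlet polynomial if it is of the form
`s ↦ ∑_{n=1}^N a_n n^{-s}`. -/
def IsDirichletPolynomial (f : rightHalfPlane →ᵇ ℂ) : Prop :=
  ∃ (a : ℕ → ℂ) (N : ℕ), ∀ s : rightHalfPlane, f s = dirichletPartialSum a N s

theorem IsDirichletPolynomial.add {f g : rightHalfPlane →ᵇ ℂ}
    (hf : IsDirichletPolynomial f) (hg : IsDirichletPolynomial g) :
    IsDirichletPolynomial (f + g) := by
  obtain ⟨a, N, ha⟩ := hf
  obtain ⟨b, M, hb⟩ := hg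
  refine ⟨fun n => (if n ≤ N then a n else 0) + (if n ≤ M then b n else 0), max N M, fun s => ?_⟩
  have key : ∀ (c : ℕ → ℂ) (K : ℕ), K ≤ max N M →
      dirichletPartialSum c K s =
        ∑ n ∈ Finset.Icc 1 (max N M), (if n ≤ K then c n else 0) * (n : ℂ) ^ (-(s : ℂ)) := by
    intro c K hK
    have hsub : Finset.Icc 1 K ⊆ Finset.Icc 1 (max N M) := Finset.Icc_subset_Icc_right hK
    rw [dirichletPartialSum, ← Finset.sum_subset hsub]
    · refine Finset.sum_congr rfl fun n hn => ?_
      rw [if_pos (Finset.mem_Icc.1 hn).2]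
    · intro n hn hn'
      have : ¬ n ≤ K := fun h => hn' (Finset.mem_Icc.2 ⟨(Finset.mem_Icc.1 hn).1, h⟩)
      rw [if_neg this, zero_mul]
  rw [BoundedContinuousFunction.add_apply, ha, hb, key a N (le_max_left _ _),
    key b M (le_max_right _ _), ← Finset.sum_add_distrib, dirichletPartialSum]
  exact Finset.sum_congr rfl fun n _ => (add_mul _ _ _).symm

theorem IsDirichletPolynomial.mul {f g : rightHalfPlane →ᵇ ℂ}
    (hf : IsDirichletPolynomial f) (hg : IsDirichletPolynomial g) :
    IsDirichletPolynomial (f * g) := by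
  obtain ⟨a, N, ha⟩ := hf
  obtain ⟨b, M, hb⟩ := hg
  let S : Finset (ℕ × ℕ) := Finset.Icc 1 N ×ˢ Finset.Icc 1 M
  refine ⟨fun k => ∑ p ∈ S with p.1 * p.2 = k, a p.1 * b p.2, N * M, fun s => ?_⟩
  have hmaps : ∀ p ∈ S, p.1 * p.2 ∈ Finset.Icc 1 (N * M) := by
    intro p hp
    obtain ⟨h1, h2⟩ := Finset.mem_product.1 hp
    rw [Finset.mem_Icc] at h1 h2 ⊢
    exact ⟨Nat.mul_pos h1.1 h2.1, Nat.mul_le_mul h1.2 h2.2⟩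
  rw [BoundedContinuousFunction.mul_apply, ha, hb]
  simp only [dirichletPartialSum]
  rw [Finset.sum_mul_sum, ← Finset.sum_product',
    ← Finset.sum_fiberwise_of_maps_to (t := Finset.Icc 1 (N * M)) hmaps]
  refine Finset.sum_congr rfl fun k _ => ?_
  rw [Finset.sum_mul]
  refine Finset.sum_congr rfl fun p hp => ?_
  rw [← (Finset.mem_filter.1 hp).2, Nat.cast_mul, Complex.natCast_mul_natCast_cpow]
  ring

theorem isDirichletPolynomial_algebraMap (c : ℂ) :
    IsDirichletPolynomial (algebraMap ℂ (rightHalfPlane →ᵇ ℂ) c) :=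
  ⟨fun _ => c, 1, fun s => by simp [dirichletPartialSum]⟩

/-- The algebra of Dirichlet polynomials, inside the Banach algebra of bounded continuous
functions on `ℂ₀` with the supremum norm. -/
noncomputable def dirichletPolynomials : Subalgebra ℂ (rightHalfPlane →ᵇ ℂ) where
  carrier := {f | IsDirichletPolynomial f}
  mul_mem' := IsDirichletPolynomial.mul
  add_mem' := IsDirichletPolynomial.add
  algebraMap_mem' := isDirichletPolynomial_algebraMap

/-- The Banach algebra `𝒜(ℂ₀)` of all functions on `ℂ₀` that are uniform limits on `ℂ₀` of
Dirichlet polynomials, with the supremum norm. -/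
noncomputable def algebraA : Subalgebra ℂ (rightHalfPlane →ᵇ ℂ) :=
  dirichletPolynomials.topologicalClosure

/-- Membership in `𝒜(ℂ₀)`, spelled out with a uniformly convergent sequence. -/
theorem mem_algebraA_iff (f : rightHalfPlane →ᵇ ℂ) :
    f ∈ algebraA ↔ ∃ (a : ℕ → ℕ → ℂ) (N : ℕ → ℕ),
      TendstoUniformly (fun k (s : rightHalfPlane) => dirichletPartialSum (a k) (N k) s)
        f atTop := by
  have h0 : f ∈ algebraA ↔ f ∈ closure {g : rightHalfPlane →ᵇ ℂ | IsDirichletPolynomial g} :=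
    Iff.rfl
  rw [h0, mem_closure_iff_seq_limit]
  constructor
  · rintro ⟨x, hx, hlim⟩
    choose a N h using hx
    refine ⟨a, N, ?_⟩
    rw [BoundedContinuousFunction.tendsto_iff_tendstoUniformly] at hlim
    convert hlim using 2 with k
    funext s
    exact (h k s).symm
  · rintro ⟨a, N, h⟩
    have hcont : ∀ k, Continuous
        (fun s : rightHalfPlane => dirichletPartialSum (a k) (N k) (s : ℂ)) := by
      intro k
      refine continuous_finsetSum _ fun n hn => continuous_const.mul ?_
      have hn' : (n : ℂ) ≠ 0 := Nat.cast_ne_zero.2 (by have := (Finset.mem_Icc.1 hn).1; omega)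
      exact (continuous_subtype_val.neg).const_cpow (Or.inl hn')
    have hbd : ∀ k (s : rightHalfPlane), ‖dirichletPartialSum (a k) (N k) (s : ℂ)‖ ≤
        ∑ n ∈ Finset.Icc 1 (N k), ‖a k n‖ := by
      intro k s
      refine norm_sum_le_of_le _ fun n hn => ?_
      have hn1 : 1 ≤ n := (Finset.mem_Icc.1 hn).1
      have hs : 0 < (s : ℂ).re := s.2
      rw [norm_mul, Complex.norm_natCast_cpow_of_pos hn1]
      refine mul_le_of_le_one_right (norm_nonneg _) ?_
      exact Real.rpow_le_one_of_one_le_of_nonpos (by exact_mod_cast hn1) (by simpa using hs.le)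
    refine ⟨fun k => BoundedContinuousFunction.ofNormedAddCommGroup _ (hcont k) _ (hbd k),
      fun k => ⟨a k, N k, fun s => rfl⟩, ?_⟩
    rw [BoundedContinuousFunction.tendsto_iff_tendstoUniformly]
    exact h

/-- `f` is represented by the Dirichlet series `∑ a_n n^{-s}` in some half-plane: the (ordinary,
possibly only conditional) sum of the series is `f s` whenever `Re s` is large enough. -/
def RepresentedBy (f : rightHalfPlane →ᵇ ℂ) (a : ℕ → ℂ) : Prop :=
  ∃ σ : ℝ, ∀ s : rightHalfPlane, σ < (s : ℂ).re →
    Tendsto (fun N : ℕ => dirichletPartialSum a N s) atTop (𝓝 (f s))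

/-- The set `ℳ` of those `D ∈ 𝒜(ℂ₀)` whose Dirichlet series has abscissa of absolute
convergence exactly `1/2`. -/
def maximalStrip : Set algebraA :=
  {D | ∃ a : ℕ → ℂ, RepresentedBy (D : rightHalfPlane →ᵇ ℂ) a ∧
    LSeries.abscissaOfAbsConv a = ((1 / 2 : ℝ) : EReal)}

/-- `S` is algebraically independent, and the (not necessarily unital) algebra that it generates,
which is then the free commutative algebra on `S`, is contained in `Z ∪ {0}`. -/
def FreelyGeneratesIn {A : Type*} [CommRing A] [Algebra ℂ A] (S Z : Set A) : Prop :=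
  AlgebraicIndependent ℂ (Subtype.val : S → A) ∧
    (NonUnitalAlgebra.adjoin ℂ S : Set A) ⊆ Z ∪ {0}

/-- `Z` is strongly `κ`-algebrable: some (not necessarily unital) subalgebra generated by an
algebraically independent set of cardinality `κ` is contained in `Z ∪ {0}`. -/
def StronglyAlgebrable {A : Type*} [CommRing A] [Algebra ℂ A] (κ : Cardinal) (Z : Set A) : Prop :=
  ∃ S : Set A, Cardinal.mk S = κ ∧ FreelyGeneratesIn S Z

/-!
A polynomial expression `Q(D)` in elements of `𝒜(ℂ₀)` has `σ_a ≤ 1/2` for a soft reason: the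
coefficients of every `f ∈ 𝒜(ℂ₀)` are square summable (`exists_lSeriesHasSum`), because the mean of
`|P(σ + it)|²` over `t` is `∑ |a_n|² n^{-2σ}` for a Dirichlet polynomial `P`, and Cauchy–Schwarz does
the rest. Taking coefficients is then an algebra homomorphism `dirichletCoeffHom` into the
arithmetic functions under Dirichlet convolution.

For the lower bound, the Bohnenblust–Hille construction (`exists_prime_block`) gives, for every
`σ < 1/2`, Dirichlet polynomials of norm at most `1` with `∑ |a_n| n^{-σ}` arbitrarily large, whose
frequencies `n` are products of a fixed number of primes beyond any given bound. Summing such blocks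
over disjoint ranges of primes yields functions with the property `HasIsolatedBlocks`. The decisive
remark is that this property passes to polynomials. If `n` belongs to a block of `D_{i₀}` and `l` is
small, then, as far as the coefficients at divisors of `l n` are concerned, `D_{i₀}` is `E + a_n n^{-s}`
with `E` supported on divisors of `l`, the other `D_i` are supported on divisors of `l`, and the square
of `n^{-s}` vanishes. By Taylor's formula the coefficient of `Q(D)` at `l n` is therefore `a_n` times
the coefficient of `(∂Q/∂x_{i₀})(D)`
at `l` (`ArithmeticFunction.aeval_apply_mul_of_isolated`). By induction on the degree,
`(∂Q/∂x_{i₀})(D)` is nonzero for some `i₀` unless `Q` is constant, and the mass of the blocks of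
`D_{i₀}` forces `∑ |b_n| n^{-σ} = ∞` for the coefficients `b_n` of `Q(D)`
(`HasIsolatedBlocks.absDivergesBelowHalf`).

Blocks distributed over countably many functions give the algebraically independent set. For the
generic statement, normalise `Q` to have coefficient vector on the unit sphere of `ℂ^d`: by compactness
the conditions "`∑_{n ∈ F} |b_n| n^{-σ} > k` for some finite `F`, for all such `Q`" are open in `D`
(`isOpen_largeOnSphere`), and they all hold at `P + ε W` for every Dirichlet polynomial `P`, every `ε ≠ 0`
and a fixed `W` with isolated blocks, so that their intersection is a dense `G_δ`.
-/

/-! ### Mean values and square summability of the coefficients of a Dirichlet polynomial -/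

theorem tendsto_average_pow {w : ℂ} (hw : ‖w‖ = 1) :
    Tendsto (fun T : ℕ => (T : ℂ)⁻¹ * ∑ t ∈ Finset.range T, w ^ t) atTop
      (𝓝 (if w = 1 then 1 else 0)) := by
  split_ifs with h
  · refine tendsto_const_nhds.congr' ?_
    filter_upwards [eventually_gt_atTop 0] with T hT
    have : (T : ℂ) ≠ 0 := Nat.cast_ne_zero.2 hT.ne'
    simp [h, this]
  · refine squeeze_zero_norm (a := fun T : ℕ => (T : ℝ)⁻¹ * (2 / ‖w - 1‖)) (fun T => ?_) ?_
    · rw [norm_mul, norm_inv, Complex.norm_natCast, geom_sum_eq h, norm_div]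
      gcongr
      refine (norm_sub_le _ _).trans ?_
      rw [norm_pow, hw]; norm_num
    · simpa using (tendsto_inv_atTop_nhds_zero_nat (𝕜 := ℝ)).mul_const (2 / ‖w - 1‖)

/-- A discrete mean value inequality: the mean over `t ∈ ℕ` of `|∑ b_i z_i ^ t|²` is `∑ |b_i|²` when
the `z_i` are distinct points of the unit circle. -/
theorem sum_norm_sq_le_of_forall_norm_sum_pow_le {ι : Type*} [DecidableEq ι] (s : Finset ι)
    (z b : ι → ℂ) (hz : ∀ i ∈ s, ‖z i‖ = 1) (hinj : Set.InjOn z s) {M : ℝ}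
    (h : ∀ t : ℕ, ‖∑ i ∈ s, b i * z i ^ t‖ ≤ M) :
    ∑ i ∈ s, ‖b i‖ ^ 2 ≤ M ^ 2 := by
  have hconj : ∀ i ∈ s, ∀ j ∈ s, z i * starRingEnd ℂ (z j) = 1 ↔ i = j := by
    intro i hi j hj
    have hj1 : z j * starRingEnd ℂ (z j) = 1 := by
      rw [Complex.mul_conj, Complex.normSq_eq_norm_sq, hz j hj]; norm_num
    have hne : starRingEnd ℂ (z j) ≠ 0 := right_ne_zero_of_mul_eq_one hj1
    constructor
    · intro hij
      exact hinj hi hj (mul_right_cancel₀ hne (hij.trans hj1.symm))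
    · rintro rfl; exact hj1
  have key : Tendsto (fun T : ℕ => ∑ i ∈ s, ∑ j ∈ s, b i * starRingEnd ℂ (b j) *
      ((T : ℂ)⁻¹ * ∑ t ∈ Finset.range T, (z i * starRingEnd ℂ (z j)) ^ t)) atTop
      (𝓝 (∑ i ∈ s, ∑ j ∈ s, b i * starRingEnd ℂ (b j) *
        (if z i * starRingEnd ℂ (z j) = 1 then 1 else 0))) := by
    refine tendsto_finsetSum _ fun i hi => tendsto_finsetSum _ fun j hj => ?_
    refine (tendsto_average_pow ?_).const_mul _
    rw [norm_mul, RCLike.norm_conj, hz i hi, hz j hj, one_mul]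
  have hlim : (∑ i ∈ s, ∑ j ∈ s, b i * starRingEnd ℂ (b j) *
        (if z i * starRingEnd ℂ (z j) = 1 then 1 else 0)) = ((∑ i ∈ s, ‖b i‖ ^ 2 : ℝ) : ℂ) := by
    rw [Complex.ofReal_sum]
    refine Finset.sum_congr rfl fun i hi => ?_
    rw [Finset.sum_eq_single_of_mem i hi]
    · rw [if_pos ((hconj i hi i hi).2 rfl), mul_one, Complex.mul_conj, Complex.normSq_eq_norm_sq]
    · intro j hj hji
      rw [if_neg fun h' => hji ((hconj i hi j hj).1 h').symm, mul_zero]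
  rw [hlim] at key
  have hre := (Complex.continuous_re.tendsto _).comp key
  rw [Complex.ofReal_re] at hre
  refine le_of_tendsto hre ?_
  filter_upwards [eventually_gt_atTop 0] with T hT
  have hTpos : (0 : ℝ) < T := Nat.cast_pos.2 hT
  have hsq : (∑ i ∈ s, ∑ j ∈ s, b i * starRingEnd ℂ (b j) *
      ((T : ℂ)⁻¹ * ∑ t ∈ Finset.range T, (z i * starRingEnd ℂ (z j)) ^ t)) =
      (((T : ℝ)⁻¹ * ∑ t ∈ Finset.range T, ‖∑ i ∈ s, b i * z i ^ t‖ ^ 2 : ℝ) : ℂ) := by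
    push_cast
    have : ∀ t, ((‖∑ i ∈ s, b i * z i ^ t‖ : ℂ)) ^ 2 =
        ∑ i ∈ s, ∑ j ∈ s, b i * starRingEnd ℂ (b j) * (z i * starRingEnd ℂ (z j)) ^ t := by
      intro t
      rw [← Complex.mul_conj', map_sum, Finset.sum_mul_sum]
      refine Finset.sum_congr rfl fun i _ => Finset.sum_congr rfl fun j _ => ?_
      rw [map_mul, map_pow, mul_pow]; ring
    simp only [this]
    simp only [Finset.mul_sum]
    rw [Finset.sum_comm (s := Finset.range T)]
    refine Finset.sum_congr rfl fun i _ => ?_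
    rw [Finset.sum_comm]
    refine Finset.sum_congr rfl fun t _ => Finset.sum_congr rfl fun j _ => by ring
  simp only [Function.comp_apply]
  rw [hsq, Complex.ofReal_re, inv_mul_le_iff₀ hTpos]
  calc ∑ t ∈ Finset.range T, ‖∑ i ∈ s, b i * z i ^ t‖ ^ 2
      ≤ ∑ t ∈ Finset.range T, M ^ 2 :=
        Finset.sum_le_sum fun t _ => pow_le_pow_left₀ (norm_nonneg _) (h t) 2
    _ = T * M ^ 2 := by simp

theorem sum_norm_sq_le_norm_sq_of_eq_dirichletPartialSum {f : rightHalfPlane →ᵇ ℂ} {a : ℕ → ℂ}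
    {N : ℕ} (hf : ∀ s : rightHalfPlane, f s = dirichletPartialSum a N s) :
    ∑ n ∈ Finset.Icc 1 N, ‖a n‖ ^ 2 ≤ ‖f‖ ^ 2 := by
  have hσ : ∀ σ : ℝ, 0 < σ →
      ∑ n ∈ Finset.Icc 1 N, ‖a n * (n : ℂ) ^ (-(σ : ℂ))‖ ^ 2 ≤ ‖f‖ ^ 2 := by
    intro σ hσ
    -- a step so small that the numbers `n ^ (-ih)`, `n ≤ N`, are distinct
    obtain ⟨h, hh0, hhN⟩ : ∃ h : ℝ, 0 < h ∧ h * Real.log N < Real.pi := by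
      refine ⟨Real.pi / (|Real.log N| + 1), by positivity, ?_⟩
      rw [div_mul_eq_mul_div, div_lt_iff₀ (by positivity)]
      have := le_abs_self (Real.log N)
      exact mul_lt_mul_of_pos_left (by linarith) Real.pi_pos
    have hexp : ∀ n ∈ Finset.Icc 1 N, ∀ w : ℂ, (n : ℂ) ^ w = Complex.exp ((Real.log n : ℝ) * w) := by
      intro n hn w
      have hn0 : (n : ℂ) ≠ 0 := Nat.cast_ne_zero.2 (by have := (Finset.mem_Icc.1 hn).1; omega)
      rw [Complex.cpow_def_of_ne_zero hn0, Complex.natCast_log]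
    refine sum_norm_sq_le_of_forall_norm_sum_pow_le (Finset.Icc 1 N)
      (fun n => (n : ℂ) ^ (-(h * Complex.I))) _ ?_ ?_ ?_
    · intro n hn
      rw [hexp n hn, show ((Real.log n : ℝ) : ℂ) * (-(h * Complex.I)) =
        ((-(Real.log n * h) : ℝ) : ℂ) * Complex.I by push_cast; ring, Complex.norm_exp_ofReal_mul_I]
    · intro n hn m hm hnm
      have hn1 := Finset.mem_Icc.1 (Finset.mem_coe.1 hn)
      have hm1 := Finset.mem_Icc.1 (Finset.mem_coe.1 hm)
      have him : ∀ k ∈ Finset.Icc 1 N, -Real.pi < (((Real.log k : ℝ) : ℂ) * (-(h * Complex.I))).im ∧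
          (((Real.log k : ℝ) : ℂ) * (-(h * Complex.I))).im ≤ Real.pi := by
        intro k hk
        have hk1 := Finset.mem_Icc.1 hk
        have h0 : 0 ≤ Real.log k := Real.log_natCast_nonneg k
        have h1 : Real.log k ≤ Real.log N :=
          Real.log_le_log (by exact_mod_cast hk1.1) (by exact_mod_cast hk1.2)
        have e : (((Real.log k : ℝ) : ℂ) * (-(h * Complex.I))).im = -(h * Real.log k) := by
          rw [Complex.im_ofReal_mul]; simp [mul_comm]
        rw [e]
        have h2 : h * Real.log k ≤ h * Real.log N := mul_le_mul_of_nonneg_left h1 hh0.le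
        have h3 : 0 ≤ h * Real.log k := mul_nonneg hh0.le h0
        constructor <;> linarith [Real.pi_pos]
      simp only [] at hnm
      rw [hexp n hn, hexp m hm] at hnm
      have := Complex.exp_inj_of_neg_pi_lt_of_le_pi (him n hn).1 (him n hn).2 (him m hm).1
        (him m hm).2 hnm
      have hne : -((h : ℂ) * Complex.I) ≠ 0 := by
        simp [hh0.ne']
      have := mul_right_cancel₀ hne this
      have := Complex.ofReal_injective this
      have := Real.log_injOn_pos (Set.mem_Ioi.2 (by exact_mod_cast hn1.1))
        (Set.mem_Ioi.2 (by exact_mod_cast hm1.1)) this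
      exact_mod_cast this
    · intro t
      have hs : 0 < ((σ : ℂ) + t * (h * Complex.I)).re := by simpa using hσ
      have := f.norm_coe_le_norm ⟨_, hs⟩
      rw [hf] at this
      refine le_of_eq_of_le (congrArg _ ?_) this
      refine Finset.sum_congr rfl fun n hn => ?_
      have hn0 : (n : ℂ) ≠ 0 := Nat.cast_ne_zero.2 (by have := (Finset.mem_Icc.1 hn).1; omega)
      rw [mul_assoc, ← Complex.cpow_nat_mul, ← Complex.cpow_add _ _ hn0]
      congr 2; ring
  have hlim : Tendsto (fun σ : ℝ => ∑ n ∈ Finset.Icc 1 N, ‖a n * (n : ℂ) ^ (-(σ : ℂ))‖ ^ 2)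
      (𝓝[>] 0) (𝓝 (∑ n ∈ Finset.Icc 1 N, ‖a n‖ ^ 2)) := by
    refine tendsto_finsetSum _ fun n hn => ?_
    have hn0 : (n : ℂ) ≠ 0 := Nat.cast_ne_zero.2 (by have := (Finset.mem_Icc.1 hn).1; omega)
    have hc : Continuous fun σ : ℝ => ‖a n * (n : ℂ) ^ (-(σ : ℂ))‖ ^ 2 := by
      refine ((continuous_const.mul ?_).norm).pow 2
      exact (Complex.continuous_ofReal.neg).const_cpow (Or.inl hn0)
    have := (hc.tendsto 0).mono_left (nhdsWithin_le_nhds (s := Set.Ioi 0))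
    simpa using this
  exact le_of_tendsto hlim (by filter_upwards [self_mem_nhdsWithin] with σ h using hσ σ h)

/-! ### The Dirichlet series of a function in `𝒜(ℂ₀)` -/

/-- `v` is the finitely supported coefficient sequence of the Dirichlet polynomial `g`, seen as
an element of `ℓ²`. -/
def IsCoeffVector (g : rightHalfPlane →ᵇ ℂ) (v : lp (fun _ : ℕ => ℂ) 2) : Prop :=
  ∃ N : ℕ, (∀ n, n ∉ Finset.Icc 1 N → v n = 0) ∧
    ∀ s : rightHalfPlane, g s = dirichletPartialSum v N s

theorem IsDirichletPolynomial.exists_isCoeffVector {g : rightHalfPlane →ᵇ ℂ}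
    (hg : IsDirichletPolynomial g) : ∃ v, IsCoeffVector g v := by
  obtain ⟨a, N, h⟩ := hg
  have hv : ∀ m, (∑ n ∈ Finset.Icc 1 N, lp.single (E := fun _ : ℕ => ℂ) 2 n (a n)) m =
      if m ∈ Finset.Icc 1 N then a m else 0 := by
    intro m
    simp only [lp.coeFn_sum, Finset.sum_apply, lp.coeFn_single, Finset.sum_pi_single]
  refine ⟨∑ n ∈ Finset.Icc 1 N, lp.single 2 n (a n), N, fun n hn => by rw [hv, if_neg hn],
    fun s => ?_⟩
  rw [h, dirichletPartialSum, dirichletPartialSum]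
  exact Finset.sum_congr rfl fun n hn => by rw [hv, if_pos hn]

theorem IsCoeffVector.sub {g g' : rightHalfPlane →ᵇ ℂ} {v v' : lp (fun _ : ℕ => ℂ) 2}
    (h : IsCoeffVector g v) (h' : IsCoeffVector g' v') : IsCoeffVector (g - g') (v - v') := by
  obtain ⟨N, h0, hs⟩ := h
  obtain ⟨N', h0', hs'⟩ := h'
  have key : ∀ (c : ℕ → ℂ) (K : ℕ), K ≤ max N N' → (∀ n, n ∉ Finset.Icc 1 K → c n = 0) →
      ∀ s, dirichletPartialSum c K s = dirichletPartialSum c (max N N') s := by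
    intro c K hK hc s
    refine Finset.sum_subset (Finset.Icc_subset_Icc_right hK) fun n _ hn => ?_
    rw [hc n hn, zero_mul]
  refine ⟨max N N', fun n hn => ?_, fun s => ?_⟩
  · have h1 : n ∉ Finset.Icc 1 N :=
      fun h => hn (Finset.Icc_subset_Icc_right (le_max_left _ _) h)
    have h2 : n ∉ Finset.Icc 1 N' :=
      fun h => hn (Finset.Icc_subset_Icc_right (le_max_right _ _) h)
    simp [h0 n h1, h0' n h2]
  · rw [BoundedContinuousFunction.sub_apply, hs, hs', key v N (le_max_left _ _) h0,
      key v' N' (le_max_right _ _) h0']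
    simp only [dirichletPartialSum, ← Finset.sum_sub_distrib, ← sub_mul]
    rfl

theorem IsCoeffVector.norm_le {g : rightHalfPlane →ᵇ ℂ} {v : lp (fun _ : ℕ => ℂ) 2}
    (h : IsCoeffVector g v) : ‖v‖ ≤ ‖g‖ := by
  obtain ⟨N, h0, hs⟩ := h
  have h1 := sum_norm_sq_le_norm_sq_of_eq_dirichletPartialSum hs
  have h2 := lp.norm_rpow_eq_tsum (p := 2) (by norm_num) v
  rw [tsum_eq_sum (s := Finset.Icc 1 N) (fun n hn => by simp [h0 n hn])] at h2
  simp only [ENNReal.toReal_ofNat, Real.rpow_ofNat] at h2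
  rw [← h2] at h1
  exact (sq_le_sq₀ (norm_nonneg _) (norm_nonneg _)).1 h1

theorem memlp_two_natCast_cpow {s : ℂ} (hs : 1 / 2 < s.re) :
    Memℓp (fun n : ℕ => if n = 0 then 0 else starRingEnd ℂ ((n : ℂ) ^ (-s))) 2 := by
  refine memℓp_gen ?_
  have : Summable fun n : ℕ => (n : ℝ) ^ (-(2 * s.re)) :=
    Real.summable_nat_rpow.2 (by linarith)
  refine Summable.of_nonneg_of_le (fun n => by positivity) (fun n => ?_) this
  split_ifs with h
  · simp [h]; positivity
  · rw [RCLike.norm_conj, Complex.norm_natCast_cpow_of_pos (Nat.pos_of_ne_zero h),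
      ENNReal.toReal_ofNat, ← Real.rpow_mul (Nat.cast_nonneg n), Complex.neg_re]
    exact le_of_eq (by congr 1; ring)

/-- The vector `(conj (n ^ (-s)))_{n ≥ 1}` of `ℓ²`; the inner product against it evaluates a
Dirichlet series with square summable coefficients at `s`. -/
noncomputable def evalVector (s : ℂ) (hs : 1 / 2 < s.re) : lp (fun _ : ℕ => ℂ) 2 :=
  ⟨_, memlp_two_natCast_cpow hs⟩

theorem inner_evalVector_apply {s : ℂ} (hs : 1 / 2 < s.re) (v : lp (fun _ : ℕ => ℂ) 2) (n : ℕ) :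
    inner ℂ (evalVector s hs n) (v n) = LSeries.term v s n := by
  have he : evalVector s hs n = if n = 0 then 0 else starRingEnd ℂ ((n : ℂ) ^ (-s)) := rfl
  rw [he, LSeries.term_def]
  split_ifs with h
  · simp
  · simp [Complex.cpow_neg, div_eq_mul_inv]

theorem hasSum_term_inner_evalVector {s : ℂ} (hs : 1 / 2 < s.re) (v : lp (fun _ : ℕ => ℂ) 2) :
    LSeriesHasSum v s (inner ℂ (evalVector s hs) v) := by
  have := lp.hasSum_inner (𝕜 := ℂ) (evalVector s hs) v
  simp only [inner_evalVector_apply] at this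
  exact this

theorem LSeries_term_of_pos (a : ℕ → ℂ) (s : ℂ) {n : ℕ} (hn : 1 ≤ n) :
    LSeries.term a s n = a n * (n : ℂ) ^ (-s) := by
  rw [LSeries.term_of_ne_zero (by omega), Complex.cpow_neg, div_eq_mul_inv]

theorem IsCoeffVector.inner_evalVector {g : rightHalfPlane →ᵇ ℂ} {v : lp (fun _ : ℕ => ℂ) 2}
    (h : IsCoeffVector g v) (s : rightHalfPlane) (hs : 1 / 2 < (s : ℂ).re) :
    inner ℂ (evalVector s hs) v = g s := by
  obtain ⟨N, h0, hg⟩ := h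
  refine (hasSum_term_inner_evalVector hs v).unique ?_
  have : HasSum (LSeries.term v s) (∑ n ∈ Finset.Icc 1 N, LSeries.term v s n) := by
    refine hasSum_sum_of_ne_finset_zero fun n hn => ?_
    rw [LSeries.term_def, h0 n hn]; simp
  rw [hg, dirichletPartialSum]
  convert this using 1
  exact Finset.sum_congr rfl fun n hn =>
    (LSeries_term_of_pos _ _ (Finset.mem_Icc.1 hn).1).symm

/-- Every function in `𝒜(ℂ₀)` is the sum, for `Re s > 1/2`, of an absolutely convergent Dirichlet
series with square summable coefficients. -/
theorem exists_lSeriesHasSum {f : rightHalfPlane →ᵇ ℂ} (hf : f ∈ algebraA) :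
    ∃ v : lp (fun _ : ℕ => ℂ) 2, v 0 = 0 ∧ ‖v‖ ≤ ‖f‖ ∧
      ∀ s : rightHalfPlane, 1 / 2 < (s : ℂ).re → LSeriesHasSum v s (f s) := by
  obtain ⟨g, hg, hlim⟩ := mem_closure_iff_seq_limit.1
    (show f ∈ closure {g : rightHalfPlane →ᵇ ℂ | IsDirichletPolynomial g} from hf)
  choose v hv using fun k => (hg k).exists_isCoeffVector
  have hcau : CauchySeq v := by
    have := hlim.cauchySeq
    rw [Metric.cauchySeq_iff] at this ⊢
    intro ε hε
    obtain ⟨N, hN⟩ := this ε hε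
    refine ⟨N, fun m hm n hn => lt_of_le_of_lt ?_ (hN m hm n hn)⟩
    rw [dist_eq_norm, dist_eq_norm]
    exact ((hv m).sub (hv n)).norm_le
  obtain ⟨w, hw⟩ := cauchySeq_tendsto_of_complete hcau
  refine ⟨w, ?_, le_of_tendsto_of_tendsto' hw.norm hlim.norm fun k => (hv k).norm_le, ?_⟩
  · have h1 : Tendsto (fun k => v k 0) atTop (𝓝 (w 0)) := by
      refine squeeze_zero_norm' (a := fun k => ‖v k - w‖) ?_ ?_ |> tendsto_sub_nhds_zero_iff.1
      · exact Eventually.of_forall fun k => lp.norm_apply_le_norm two_ne_zero (v k - w) 0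
      · exact tendsto_iff_norm_sub_tendsto_zero.1 hw
    refine tendsto_nhds_unique h1 (tendsto_const_nhds.congr fun k => ?_)
    obtain ⟨N, h0, -⟩ := hv k
    exact (h0 0 (by simp)).symm
  · intro s hs
    have h1 : Tendsto (fun k => inner ℂ (evalVector s hs) (v k)) atTop
        (𝓝 (inner ℂ (evalVector s hs) w)) := tendsto_const_nhds.inner hw
    have h2 : Tendsto (fun k => g k s) atTop (𝓝 (f s)) :=
      (BoundedContinuousFunction.tendsto_iff_tendstoUniformly.1 hlim).tendsto_at s
    have h3 := tendsto_nhds_unique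
      (h1.congr fun k => (hv k).inner_evalVector s hs) h2
    rw [← h3]
    exact hasSum_term_inner_evalVector hs w

theorem exists_arithmeticFunction (f : algebraA) :
    ∃ a : ArithmeticFunction ℂ, (∀ n, ‖a n‖ ≤ ‖f‖) ∧
      ∀ s : rightHalfPlane, 1 / 2 < (s : ℂ).re → LSeriesHasSum a s ((f : rightHalfPlane →ᵇ ℂ) s) := by
  obtain ⟨v, h0, hv, hs⟩ := exists_lSeriesHasSum f.2
  exact ⟨⟨v, h0⟩, fun n => (lp.norm_apply_le_norm two_ne_zero v n).trans hv, hs⟩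

/-- The coefficients of the Dirichlet series of `f ∈ 𝒜(ℂ₀)`, as an arithmetic function. -/
noncomputable def dirichletCoeff (f : algebraA) : ArithmeticFunction ℂ :=
  (exists_arithmeticFunction f).choose

theorem norm_dirichletCoeff_apply_le (f : algebraA) (n : ℕ) : ‖dirichletCoeff f n‖ ≤ ‖f‖ :=
  (exists_arithmeticFunction f).choose_spec.1 n

theorem lSeriesHasSum_dirichletCoeff (f : algebraA) {s : rightHalfPlane}
    (hs : 1 / 2 < (s : ℂ).re) :
    LSeriesHasSum (dirichletCoeff f) s ((f : rightHalfPlane →ᵇ ℂ) s) :=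
  (exists_arithmeticFunction f).choose_spec.2 s hs

/-- Uniqueness of the Dirichlet series representing a function. -/
theorem dirichletCoeff_eq_of_lSeriesHasSum (f : algebraA) (a : ArithmeticFunction ℂ)
    (h : ∀ s : rightHalfPlane, 1 / 2 < (s : ℂ).re →
      LSeriesHasSum a s ((f : rightHalfPlane →ᵇ ℂ) s)) :
    dirichletCoeff f = a := by
  have hlt : ∀ b : ArithmeticFunction ℂ, (∀ s : rightHalfPlane, 1 / 2 < (s : ℂ).re →
      LSeriesHasSum b s ((f : rightHalfPlane →ᵇ ℂ) s)) → LSeries.abscissaOfAbsConv b < ⊤ := by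
    intro b hb
    have := (hb ⟨1, by simp [rightHalfPlane]⟩ (by norm_num)).LSeriesSummable.abscissaOfAbsConv_le
    exact this.trans_lt (by simpa using EReal.coe_lt_top 1)
  ext n
  rcases eq_or_ne n 0 with rfl | hn
  · simp
  refine LSeries.eq_of_LSeries_eventually_eq
    (hlt _ fun s hs => lSeriesHasSum_dirichletCoeff f hs) (hlt a h) ?_ hn
  filter_upwards [eventually_gt_atTop 1] with x hx
  have hx0 : 0 < ((x : ℂ)).re := by simp; linarith
  have hx1 : 1 / 2 < ((x : ℂ)).re := by simp; linarith
  exact (lSeriesHasSum_dirichletCoeff f (s := ⟨x, hx0⟩) hx1).LSeries_eq.trans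
    (h ⟨x, hx0⟩ hx1).LSeries_eq.symm

/-- Passing to the coefficients is an algebra homomorphism from `𝒜(ℂ₀)` to the arithmetic
functions with Dirichlet convolution. -/
noncomputable def dirichletCoeffHom : algebraA →ₐ[ℂ] ArithmeticFunction ℂ where
  toFun := dirichletCoeff
  map_one' := by
    refine dirichletCoeff_eq_of_lSeriesHasSum _ _ fun s hs => ?_
    have := hasSum_single (f := LSeries.term (1 : ArithmeticFunction ℂ) s) 1 fun n hn => by
      rw [LSeries.term_def]; simp [ArithmeticFunction.one_apply_ne hn]
    simpa [LSeriesHasSum, LSeries.term_def] using this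
  map_zero' := by
    refine dirichletCoeff_eq_of_lSeriesHasSum _ _ fun s hs => ?_
    have : LSeries.term (0 : ArithmeticFunction ℂ) s = fun _ => 0 := by
      ext n; simp [LSeries.term_def]
    rw [LSeriesHasSum, this]
    exact hasSum_zero
  map_add' f g := by
    refine dirichletCoeff_eq_of_lSeriesHasSum _ _ fun s hs => ?_
    exact (lSeriesHasSum_dirichletCoeff f hs).add (lSeriesHasSum_dirichletCoeff g hs)
  map_mul' f g := by
    refine dirichletCoeff_eq_of_lSeriesHasSum _ _ fun s hs => ?_
    exact ArithmeticFunction.LSeriesHasSum_mul (lSeriesHasSum_dirichletCoeff f hs) (lSeriesHasSum_dirichletCoeff g hs)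
  commutes' c := by
    refine dirichletCoeff_eq_of_lSeriesHasSum _ _ fun s hs => ?_
    rw [Algebra.algebraMap_eq_smul_one]
    have := hasSum_single (f := LSeries.term (c • 1 : ArithmeticFunction ℂ) s) 1 fun n hn => by
      rw [LSeries.term_def]; simp [ArithmeticFunction.one_apply_ne hn]
    simpa [LSeriesHasSum, LSeries.term_def] using this

/-- The `n`-th coefficient as a continuous linear functional on `𝒜(ℂ₀)`. -/
noncomputable def dirichletCoeffCLM (n : ℕ) : algebraA →L[ℂ] ℂ :=
  LinearMap.mkContinuous
    { toFun := fun f => dirichletCoeff f n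
      map_add' := fun f g => by
        exact congrArg (fun a : ArithmeticFunction ℂ => a n) (map_add dirichletCoeffHom f g)
      map_smul' := fun c f => by
        exact congrArg (fun a : ArithmeticFunction ℂ => a n) (map_smul dirichletCoeffHom c f) }
    1 fun f => (norm_dirichletCoeff_apply_le f n).trans_eq (one_mul _).symm

@[simp]
theorem dirichletCoeffCLM_apply (n : ℕ) (f : algebraA) :
    dirichletCoeffCLM n f = dirichletCoeff f n := rfl

theorem representedBy_dirichletCoeff (f : algebraA) :
    RepresentedBy (f : rightHalfPlane →ᵇ ℂ) (dirichletCoeff f) := by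
  refine ⟨1 / 2, fun s hs => ?_⟩
  have := (lSeriesHasSum_dirichletCoeff f hs).tendsto_sum_nat.comp (tendsto_add_atTop_nat 1)
  refine this.congr fun N => ?_
  rw [Function.comp_apply, Finset.range_eq_Ico, Finset.sum_eq_sum_Ico_succ_bot (by omega),
    LSeries.term_zero, zero_add, dirichletPartialSum]
  exact Finset.sum_congr rfl fun n hn => LSeries_term_of_pos _ _ (Finset.mem_Ico.1 hn).1

/-- By Cauchy–Schwarz, since the coefficients are square summable. -/
theorem abscissaOfAbsConv_dirichletCoeff_le (f : algebraA) :
    LSeries.abscissaOfAbsConv (dirichletCoeff f) ≤ ((1 / 2 : ℝ) : EReal) := by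
  refine LSeries.abscissaOfAbsConv_le_of_forall_lt_LSeriesSummable fun y hy => ?_
  have hy0 : 0 < ((y : ℂ)).re := by rw [Complex.ofReal_re]; linarith
  exact (lSeriesHasSum_dirichletCoeff f (s := ⟨y, hy0⟩)
    (by rw [Complex.ofReal_re]; exact hy)).LSeriesSummable

/-- The coefficients of a Dirichlet polynomial are the evident ones. -/
theorem dirichletCoeff_of_eq_dirichletPartialSum {f : algebraA} {a : ℕ → ℂ} {N : ℕ}
    (h : ∀ s : rightHalfPlane, (f : rightHalfPlane →ᵇ ℂ) s = dirichletPartialSum a N s) (n : ℕ) :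
    dirichletCoeff f n = if n ∈ Finset.Icc 1 N then a n else 0 := by
  have := dirichletCoeff_eq_of_lSeriesHasSum f
    ⟨fun n => if n ∈ Finset.Icc 1 N then a n else 0, by simp⟩ fun s hs => ?_
  · rw [this]; rfl
  · have h1 : LSeriesHasSum (fun n => if n ∈ Finset.Icc 1 N then a n else 0) (s : ℂ)
        (∑ n ∈ Finset.Icc 1 N,
          LSeries.term (fun n => if n ∈ Finset.Icc 1 N then a n else 0) s n) := by
      refine hasSum_sum_of_ne_finset_zero fun n hn => ?_
      rw [LSeries.term_def, if_neg hn]; simp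
    have h2 : dirichletPartialSum a N s = ∑ n ∈ Finset.Icc 1 N,
        LSeries.term (fun n => if n ∈ Finset.Icc 1 N then a n else 0) s n :=
      Finset.sum_congr rfl fun n hn => by
        rw [LSeries_term_of_pos _ _ (Finset.mem_Icc.1 hn).1, if_pos hn]
    rw [h, h2]
    exact h1

/-! ### Divergence of absolute values to the left of `1/2` -/

/-- The sums `∑ |a_n| n^{-σ}` over finite sets are unbounded for every `σ < 1/2`. -/
def AbsDivergesBelowHalf (a : ℕ → ℂ) : Prop :=
  ∀ σ : ℝ, σ < 1 / 2 → ∀ C : ℝ, ∃ F : Finset ℕ, C ≤ ∑ n ∈ F, ‖a n‖ * (n : ℝ) ^ (-σ)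

theorem AbsDivergesBelowHalf.le_abscissaOfAbsConv {a : ArithmeticFunction ℂ}
    (h : AbsDivergesBelowHalf a) : ((1 / 2 : ℝ) : EReal) ≤ LSeries.abscissaOfAbsConv a := by
  by_contra! hlt
  obtain ⟨σ, h1, h2⟩ := EReal.lt_iff_exists_real_btwn.1 hlt
  have hs : LSeriesSummable a (σ : ℂ) :=
    LSeriesSummable_of_abscissaOfAbsConv_lt_re (by simpa using h1)
  obtain ⟨F, hF⟩ := h σ (EReal.coe_lt_coe_iff.1 h2) (∑' n, ‖LSeries.term a σ n‖ + 1)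
  have h3 := hs.norm.sum_le_tsum F fun n _ => norm_nonneg _
  have h4 : ∑ n ∈ F, ‖a n‖ * (n : ℝ) ^ (-σ) = ∑ n ∈ F, ‖LSeries.term a σ n‖ := by
    refine Finset.sum_congr rfl fun n _ => ?_
    rw [LSeries.norm_term_eq]
    split_ifs with hn
    · simp [hn]
    · rw [Complex.ofReal_re, Real.rpow_neg (Nat.cast_nonneg n), div_eq_mul_inv]
  linarith

theorem AbsDivergesBelowHalf.ne_zero {a : ArithmeticFunction ℂ}
    (h : AbsDivergesBelowHalf a) : a ≠ 0 := by
  rintro rfl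
  obtain ⟨F, hF⟩ := h 0 (by norm_num) 1
  norm_num at hF

theorem AbsDivergesBelowHalf.mem_maximalStrip {f : algebraA}
    (h : AbsDivergesBelowHalf (dirichletCoeff f)) : f ∈ maximalStrip :=
  ⟨dirichletCoeff f, representedBy_dirichletCoeff f,
    (abscissaOfAbsConv_dirichletCoeff_le f).antisymm h.le_abscissaOfAbsConv⟩

/-! ### Isolated blocks of coefficients -/

theorem Nat.Coprime.sum_divisorsAntidiagonal_mul {M : Type*} [AddCommMonoid M] {m n : ℕ}
    (cop : m.Coprime n) (F : ℕ → ℕ → M) :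
    ∑ x ∈ (m * n).divisorsAntidiagonal, F x.1 x.2 =
      ∑ x ∈ m.divisorsAntidiagonal, ∑ y ∈ n.divisorsAntidiagonal, F (x.1 * y.1) (x.2 * y.2) := by
  rw [← Finset.sum_product']
  symm
  apply Finset.sum_nbij fun ((i, j), k, l) ↦ (i * k, j * l)
  · rintro ⟨⟨a1, a2⟩, ⟨b1, b2⟩⟩ h
    simp only [Nat.mem_divisorsAntidiagonal, Ne, Finset.mem_product] at h
    rcases h with ⟨⟨rfl, ha⟩, ⟨rfl, hb⟩⟩
    simp only [Nat.mem_divisorsAntidiagonal, mul_eq_zero, Ne]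
    constructor
    · ring
    rw [mul_eq_zero] at *
    exact not_or_intro ha hb
  · simp only [Set.InjOn, Finset.mem_coe, Nat.mem_divisorsAntidiagonal, Finset.mem_product,
      Prod.mk_inj]
    rintro ⟨⟨a1, a2⟩, ⟨b1, b2⟩⟩ ⟨⟨h1, ha⟩, ⟨h2, hb⟩⟩ ⟨⟨c1, c2⟩, ⟨d1, d2⟩⟩ ⟨⟨h3, -⟩, ⟨h4, -⟩⟩ ⟨e1, e2⟩
    dsimp only at *
    have g1 : ∀ {x x' y y' : ℕ}, x * x' = m → y * y' = n → m.gcd (x * y) = x := by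
      rintro x x' y y' rfl rfl
      rw [Nat.gcd_mul_left, cop.coprime_mul_left.coprime_mul_right_right.gcd_eq_one, mul_one]
    have g2 : ∀ {x x' y y' : ℕ}, x * x' = m → y * y' = n → n.gcd (x * y) = y := by
      rintro x x' y y' rfl rfl
      rw [mul_comm x y, Nat.gcd_mul_left,
        cop.coprime_mul_right.coprime_mul_left_right.symm.gcd_eq_one, mul_one]
    ext <;> dsimp only
    · rw [← g1 h1 h2, e1, g1 h3 h4]
    · rw [← g1 ((mul_comm _ _).trans h1) ((mul_comm _ _).trans h2), e2,
        g1 ((mul_comm _ _).trans h3) ((mul_comm _ _).trans h4)]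
    · rw [← g2 h1 h2, e1, g2 h3 h4]
    · rw [← g2 ((mul_comm _ _).trans h1) ((mul_comm _ _).trans h2), e2,
        g2 ((mul_comm _ _).trans h3) ((mul_comm _ _).trans h4)]
  · simp only [Set.SurjOn, Set.subset_def, Finset.mem_coe, Nat.mem_divisorsAntidiagonal,
      Finset.mem_product, Set.mem_image]
    rintro ⟨b1, b2⟩ h
    use ((b1.gcd m, b2.gcd m), (b1.gcd n, b2.gcd n))
    rw [← cop.gcd_mul _, ← cop.gcd_mul _, ← h.1,
      Nat.gcd_mul_gcd_of_coprime_of_mul_eq_mul cop h.1,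
      Nat.gcd_mul_gcd_of_coprime_of_mul_eq_mul cop.symm _]
    · rw [Ne, mul_eq_zero, not_or] at h
      simp [h.2.1, h.2.2]
    rw [mul_comm n m, h.1]
  · intro x hx
    rfl

/-- The family `a` contains, arbitrarily far out, blocks of coefficients in general position:
for every index `i₀`, every `σ < 1/2` and all bounds `L`, `C` there is a finite set `T` of numbers
`n`, coprime to everything up to `L`, which carries mass at least `C` of `∑ |a_{i₀}(n)| n^{-σ}`,
such that among the numbers `l d` with `l ≤ L` and `1 ≠ d ∣ n` only `n` itself can be in the
support of a member of the family, and only of `a i₀`. -/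
def HasIsolatedBlocks {ι : Type*} (a : ι → ArithmeticFunction ℂ) : Prop :=
  ∀ (i₀ : ι) (L : ℕ) (σ : ℝ), σ < 1 / 2 → ∀ C : ℝ, ∃ T : Finset ℕ,
    C ≤ ∑ n ∈ T, ‖a i₀ n‖ * (n : ℝ) ^ (-σ) ∧
    ∀ n ∈ T, 1 < n ∧ (∀ l ∈ Finset.Icc 1 L, l.Coprime n) ∧
      ∀ i, ∀ l ∈ Finset.Icc 1 L, ∀ d, d ∣ n → d ≠ 1 → a i (l * d) ≠ 0 → i = i₀ ∧ l = 1 ∧ d = n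

/-- First order Taylor expansion: seen from the divisors of `l n`, the family `a` is `a i₀ n` times the
delta function at `n`, placed at the index `i₀`, plus functions whose relevant values are at
divisors of `l`; the square of the delta function is supported at `n²`, which does not divide `l n`.
The statement about proper divisors `d` of `n` is what makes the induction on `Q` work. -/
theorem ArithmeticFunction.aeval_apply_mul_of_isolated {ι : Type*} {a : ι → ArithmeticFunction ℂ}
    {i₀ : ι} {L n : ℕ} (hn : 1 < n) (hcop : ∀ l ∈ Finset.Icc 1 L, l.Coprime n)
    (h : ∀ i, ∀ l ∈ Finset.Icc 1 L, ∀ d, d ∣ n → d ≠ 1 → a i (l * d) ≠ 0 →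
      i = i₀ ∧ l = 1 ∧ d = n) (Q : MvPolynomial ι ℂ) :
    ∀ l ∈ Finset.Icc 1 L, ∀ d, d ∣ n → d ≠ 1 → MvPolynomial.aeval a Q (l * d) =
      if d = n then a i₀ n * MvPolynomial.aeval a (MvPolynomial.pderiv i₀ Q) l else 0 := by
  classical
  induction Q using MvPolynomial.induction_on with
  | C c =>
    intro l hl d hd hd1
    have : l * d ≠ 1 := fun h => hd1 (Nat.eq_one_of_mul_eq_one_left h)
    simp [Algebra.algebraMap_eq_smul_one,
      ArithmeticFunction.one_apply_ne this]
  | add P Q hP hQ =>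
    intro l hl d hd hd1
    simp only [map_add, ArithmeticFunction.add_apply]
    rw [hP l hl d hd hd1, hQ l hl d hd hd1]
    split_ifs <;> ring
  | mul_X Q i hQ =>
    intro l hl d hd hd1
    have hl1 := Finset.mem_Icc.1 hl
    have hd0 : d ≠ 0 := fun h0 => by
      rw [h0, zero_dvd_iff] at hd; omega
    have hcd : l.Coprime d := (hcop l hl).coprime_dvd_right hd
    have hdiv : ∀ x ∈ l.divisorsAntidiagonal, x.1 ∈ Finset.Icc 1 L ∧ x.2 ∈ Finset.Icc 1 L := by
      intro x hx
      have hx' := Nat.mem_divisorsAntidiagonal.1 hx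
      have hl0 : 0 < l := hl1.1
      have h1 : x.1 ∣ l := Dvd.intro _ hx'.1
      have h2 : x.2 ∣ l := Dvd.intro_left _ hx'.1
      exact ⟨Finset.mem_Icc.2 ⟨Nat.pos_of_dvd_of_pos h1 hl0, (Nat.le_of_dvd hl0 h1).trans hl1.2⟩,
        Finset.mem_Icc.2 ⟨Nat.pos_of_dvd_of_pos h2 hl0, (Nat.le_of_dvd hl0 h2).trans hl1.2⟩⟩
    have hai : ∀ l' ∈ Finset.Icc 1 L, a i (l' * d) =
        if d = n then (if i = i₀ ∧ l' = 1 then a i₀ n else 0) else 0 := by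
      intro l' hl'
      by_cases hz : a i (l' * d) = 0
      · rw [hz]
        split_ifs with h1 h2
        · rw [← hz, h2.1, h2.2, h1, one_mul]
        · rfl
        · rfl
      · obtain ⟨h1, h2, h3⟩ := h i l' hl' d hd hd1 hz
        rw [if_pos h3, if_pos ⟨h1, h2⟩, h1, h2, h3, one_mul]
    -- in a factorisation `d = y₁ y₂`, only the trivial ones contribute to the convolution
    have hsplit : ∀ x ∈ l.divisorsAntidiagonal, ∑ y ∈ d.divisorsAntidiagonal,
        MvPolynomial.aeval a Q (x.1 * y.1) * a i (x.2 * y.2) =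
        MvPolynomial.aeval a Q x.1 * a i (x.2 * d) +
          MvPolynomial.aeval a Q (x.1 * d) * a i x.2 := by
      intro x hx
      obtain ⟨hx1, hx2⟩ := hdiv x hx
      have hsub : ({(1, d), (d, 1)} : Finset (ℕ × ℕ)) ⊆ d.divisorsAntidiagonal := by
        intro y hy
        simp only [Finset.mem_insert, Finset.mem_singleton] at hy
        rcases hy with rfl | rfl <;> simp [hd0]
      rw [← Finset.sum_subset hsub, Finset.sum_pair]
      · simp
      · intro h'; exact hd1 (Prod.ext_iff.1 h').2
      · intro y hy hy'
        obtain ⟨hy1, -⟩ := Nat.mem_divisorsAntidiagonal.1 hy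
        simp only [Finset.mem_insert, Finset.mem_singleton, not_or] at hy'
        have hy1ne : y.1 ≠ 1 := fun h1 => hy'.1 (Prod.ext h1 (by simpa [h1] using hy1))
        have hy2ne : y.2 ≠ 1 := fun h1 => hy'.2 (Prod.ext (by simpa [h1] using hy1) h1)
        have hyd : y.1 ∣ n := (Dvd.intro _ hy1).trans hd
        have hyn : y.1 ≠ n := by
          intro h1
          have : d = n := Nat.dvd_antisymm hd (h1 ▸ Dvd.intro _ hy1)
          rw [h1, this] at hy1
          exact hy2ne (Nat.eq_of_mul_eq_mul_left (by omega) (hy1.trans (mul_one n).symm))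
        rw [hQ x.1 hx1 y.1 hyd hy1ne, if_neg hyn, zero_mul]
    rw [map_mul (MvPolynomial.aeval a), MvPolynomial.aeval_X, ArithmeticFunction.mul_apply,
      hcd.sum_divisorsAntidiagonal_mul
        (fun u v => MvPolynomial.aeval a Q u * a i v), Finset.sum_congr rfl hsplit]
    have hterm : ∀ x ∈ l.divisorsAntidiagonal, MvPolynomial.aeval a Q x.1 * a i (x.2 * d) +
          MvPolynomial.aeval a Q (x.1 * d) * a i x.2 =
        if d = n then a i₀ n * (MvPolynomial.aeval a Q x.1 *
            (Pi.single (M := fun _ => ArithmeticFunction ℂ) i₀ 1 i : ArithmeticFunction ℂ) x.2 +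
          MvPolynomial.aeval a (MvPolynomial.pderiv i₀ Q) x.1 * a i x.2) else 0 := by
      intro x hx
      obtain ⟨hx1, hx2⟩ := hdiv x hx
      rw [hai x.2 hx2, hQ x.1 hx1 d hd hd1]
      split_ifs with h1 h2
      · rw [h2.1, h2.2, Pi.single_eq_same, ArithmeticFunction.one_one]; ring
      · have : (Pi.single (M := fun _ => ArithmeticFunction ℂ) i₀ 1 i : ArithmeticFunction ℂ) x.2
            = 0 := by
          by_cases hi : i = i₀
          · rw [hi, Pi.single_eq_same]
            exact ArithmeticFunction.one_apply_ne fun h' => h2 ⟨hi, h'⟩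
          · rw [Pi.single_eq_of_ne hi]; rfl
        rw [this]; ring
      · ring
    rw [Finset.sum_congr rfl hterm]
    split_ifs with h1
    · rw [← Finset.mul_sum, Finset.sum_add_distrib, ← ArithmeticFunction.mul_apply,
        ← ArithmeticFunction.mul_apply, ← ArithmeticFunction.add_apply, MvPolynomial.pderiv_mul,
        MvPolynomial.pderiv_X, map_add, map_mul, map_mul, MvPolynomial.aeval_X, add_comm]
      congr 4
      by_cases hi : i = i₀
      · subst hi; simp
      · rw [Pi.single_eq_of_ne hi, Pi.single_eq_of_ne hi]
        simp
    · simp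

theorem HasIsolatedBlocks.absDiverges_of_aeval_pderiv_ne_zero {ι : Type*}
    {a : ι → ArithmeticFunction ℂ} (h : HasIsolatedBlocks a) (Q : MvPolynomial ι ℂ) (i₀ : ι)
    (hQ : MvPolynomial.aeval a (MvPolynomial.pderiv i₀ Q) ≠ 0) :
    AbsDivergesBelowHalf (MvPolynomial.aeval a Q) := by
  obtain ⟨l, hl⟩ : ∃ l, MvPolynomial.aeval a (MvPolynomial.pderiv i₀ Q) l ≠ 0 := by
    by_contra! h0
    exact hQ (ArithmeticFunction.ext h0)
  have hl0 : 1 ≤ l := by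
    rcases Nat.eq_zero_or_pos l with rfl | h1
    · simp at hl
    · exact h1
  intro σ hσ C
  set β := ‖MvPolynomial.aeval a (MvPolynomial.pderiv i₀ Q) l‖ * (l : ℝ) ^ (-σ) with hβ
  have hβ0 : 0 < β := mul_pos (norm_pos_iff.2 hl) (Real.rpow_pos_of_pos (by exact_mod_cast hl0) _)
  obtain ⟨T, hC, hT⟩ := h i₀ l σ hσ (C / β)
  refine ⟨T.image (l * ·), ?_⟩
  rw [Finset.sum_image fun x _ y _ hxy => Nat.eq_of_mul_eq_mul_left (by omega) hxy]
  rw [div_le_iff₀ hβ0, Finset.sum_mul] at hC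
  refine hC.trans_eq (Finset.sum_congr rfl fun n hn => ?_)
  obtain ⟨hn1, hcop, hiso⟩ := hT n hn
  rw [ArithmeticFunction.aeval_apply_mul_of_isolated hn1 hcop hiso Q l
    (Finset.mem_Icc.2 ⟨hl0, le_rfl⟩) n dvd_rfl hn1.ne', if_pos rfl, norm_mul, Nat.cast_mul,
    Real.mul_rpow (Nat.cast_nonneg _) (Nat.cast_nonneg _), hβ]
  ring

theorem MvPolynomial.exists_pderiv_ne_zero {ι : Type*} {Q : MvPolynomial ι ℂ} {m : ι →₀ ℕ}
    (hm : m ≠ 0) (hQ : Q.coeff m ≠ 0) : ∃ i, MvPolynomial.pderiv i Q ≠ 0 := by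
  obtain ⟨i, hi⟩ := Finsupp.ne_iff.1 hm
  refine ⟨i, fun h0 => ?_⟩
  have h1 := MvPolynomial.coeff_pderiv (i := i) Q (m - Finsupp.single i 1)
  have h2 : m - Finsupp.single i 1 + Finsupp.single i 1 = m := by
    refine tsub_add_cancel_of_le (Finsupp.single_le_iff.2 ?_)
    exact Nat.one_le_iff_ne_zero.2 (by simpa using hi)
  rw [h0, h2] at h1
  simp only [MvPolynomial.coeff_zero] at h1
  rcases mul_eq_zero.1 h1.symm with h3 | h3
  · exact hQ h3
  · exact Nat.cast_add_one_ne_zero _ (by simpa using h3)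

/-- A family with isolated blocks is algebraically independent; by induction on the degree, since
some partial derivative of a nonconstant `Q` is nonzero and of smaller degree. -/
theorem HasIsolatedBlocks.aeval_ne_zero {ι : Type*} {a : ι → ArithmeticFunction ℂ}
    (h : HasIsolatedBlocks a) {Q : MvPolynomial ι ℂ} (hQ : Q ≠ 0) :
    MvPolynomial.aeval a Q ≠ 0 := by
  suffices ∀ k, ∀ Q : MvPolynomial ι ℂ, Q.totalDegree ≤ k → Q ≠ 0 → MvPolynomial.aeval a Q ≠ 0 from
    this _ Q le_rfl hQ
  intro k
  have hconst : ∀ c : ℂ, (MvPolynomial.C c : MvPolynomial ι ℂ) ≠ 0 →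
      MvPolynomial.aeval a (MvPolynomial.C c : MvPolynomial ι ℂ) ≠ 0 := by
    intro c hc h0
    have h1 := congrArg (fun f : ArithmeticFunction ℂ => f 1) h0
    simp at h1
    exact hc (by rw [h1, map_zero])
  induction k with
  | zero =>
    intro Q hk hQ
    rw [MvPolynomial.totalDegree_eq_zero_iff_eq_C.1 (Nat.le_zero.1 hk)] at hQ ⊢
    exact hconst _ hQ
  | succ k ih =>
    intro Q hk hQ
    by_cases hm : ∃ m, m ≠ 0 ∧ Q.coeff m ≠ 0
    · obtain ⟨m, hm0, hm⟩ := hm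
      obtain ⟨i, hi⟩ := MvPolynomial.exists_pderiv_ne_zero hm0 hm
      refine (h.absDiverges_of_aeval_pderiv_ne_zero Q i (ih _ ?_ hi)).ne_zero
      rw [MvPolynomial.totalDegree]
      refine Finset.sup_le fun m hm => ?_
      have h1 : m + Finsupp.single i 1 ∈ Q.support := by
        rw [MvPolynomial.mem_support_iff] at hm ⊢
        rw [MvPolynomial.coeff_pderiv] at hm
        exact left_ne_zero_of_mul hm
      have h2 := (MvPolynomial.le_totalDegree h1).trans hk
      rw [Finsupp.sum_add_index' (by simp) (by simp)] at h2
      simpa using h2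
    · push Not at hm
      have : Q = MvPolynomial.C (Q.coeff 0) := by
        classical
        ext m
        rw [MvPolynomial.coeff_C]
        split_ifs with h0
        · rw [← h0]
        · exact hm m (Ne.symm h0)
      rw [this] at hQ ⊢
      exact hconst _ hQ

theorem HasIsolatedBlocks.absDivergesBelowHalf {ι : Type*} {a : ι → ArithmeticFunction ℂ}
    (h : HasIsolatedBlocks a) {Q : MvPolynomial ι ℂ} {m : ι →₀ ℕ} (hm : m ≠ 0)
    (hQ : Q.coeff m ≠ 0) : AbsDivergesBelowHalf (MvPolynomial.aeval a Q) := by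
  obtain ⟨i, hi⟩ := MvPolynomial.exists_pderiv_ne_zero hm hQ
  exact h.absDiverges_of_aeval_pderiv_ne_zero Q i (h.aeval_ne_zero hi)

/-! ### Multilinear forms with unimodular coefficients and small norm -/

/-- Parseval's identity on `ℤ/kℤ`. -/
theorem sum_norm_sq_fourier {k : ℕ} [NeZero k] (y : ZMod k → ℂ) :
    ∑ i, ‖∑ l, ZMod.stdAddChar (i * l) * y l‖ ^ 2 = k * ∑ l, ‖y l‖ ^ 2 := by
  have h : ((∑ i, ‖∑ l, ZMod.stdAddChar (i * l) * y l‖ ^ 2 : ℝ) : ℂ) =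
      ((k * ∑ l, ‖y l‖ ^ 2 : ℝ) : ℂ) := by
    push_cast
    have h1 : ∀ i : ZMod k, ((‖∑ l, ZMod.stdAddChar (i * l) * y l‖ : ℂ)) ^ 2 =
        ∑ l, ∑ l', y l * starRingEnd ℂ (y l') * ZMod.stdAddChar (i * (l - l')) := by
      intro i
      rw [← Complex.mul_conj', map_sum, Finset.sum_mul_sum]
      refine Finset.sum_congr rfl fun l _ => Finset.sum_congr rfl fun l' _ => ?_
      rw [map_mul (starRingEnd ℂ), ← AddChar.map_neg_eq_conj, mul_sub, sub_eq_add_neg, AddChar.map_add_eq_mul]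
      ring
    simp only [h1]
    rw [Finset.sum_comm, Finset.mul_sum]
    refine Finset.sum_congr rfl fun l _ => ?_
    rw [Finset.sum_comm]
    simp only [← Finset.mul_sum, AddChar.sum_mulShift _ (ZMod.isPrimitive_stdAddChar k)]
    rw [Finset.sum_eq_single l]
    · rw [sub_self, if_pos rfl, ZMod.card, Complex.mul_conj']; ring
    · intro l' _ hl'
      rw [if_neg (sub_ne_zero.2 (Ne.symm hl'))]; simp
    · simp
  exact_mod_cast h

/-- The coefficients are products `∏ ψ(g_j g_{j+1})` of entries of the `k × k` Fourier matrix; each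
further variable multiplies the `ℓ²` norm by at most `√k`, although it multiplies the number of
coefficients by `k`. -/
theorem exists_multilinear_sum_norm_sq_le (k : ℕ) [NeZero k] (m : ℕ) :
    ∃ c : ZMod k → (Fin m → ZMod k) → ℂ, (∀ i g, ‖c i g‖ = 1) ∧
      ∀ z : Fin m → ZMod k → ℂ, (∀ j i, ‖z j i‖ ≤ 1) →
        ∑ i, ‖∑ g, c i g * ∏ j, z j (g j)‖ ^ 2 ≤ (k : ℝ) ^ (m + 1) := by
  induction m with
  | zero => exact ⟨fun _ _ => 1, fun _ _ => by simp, fun z _ => by simp [ZMod.card]⟩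
  | succ m ih =>
    obtain ⟨c, hc, hsum⟩ := ih
    refine ⟨fun i g => ZMod.stdAddChar (i * g 0) * c (g 0) (Fin.tail g), fun i g => ?_,
      fun z hz => ?_⟩
    · rw [norm_mul, hc, AddChar.norm_apply, one_mul]
    · have h1 : ∀ i, ∑ g : Fin (m + 1) → ZMod k,
          ZMod.stdAddChar (i * g 0) * c (g 0) (Fin.tail g) * ∏ j, z j (g j) =
          ∑ l, ZMod.stdAddChar (i * l) *
            (z 0 l * ∑ g : Fin m → ZMod k, c l g * ∏ j, z j.succ (g j)) := by
        intro i
        rw [← (Fin.consEquiv fun _ : Fin (m + 1) => ZMod k).sum_comp, Fintype.sum_prod_type]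
        refine Finset.sum_congr rfl fun l _ => ?_
        rw [Finset.mul_sum, Finset.mul_sum]
        refine Finset.sum_congr rfl fun g _ => ?_
        have htail : Fin.tail ((Fin.consEquiv fun _ : Fin (m + 1) => ZMod k) (l, g)) = g := rfl
        simp only [htail, Fin.consEquiv_apply, Fin.cons_zero, Fin.prod_univ_succ, Fin.cons_succ]
        ring
      simp only [h1]
      rw [sum_norm_sq_fourier, pow_succ' _ (m + 1)]
      refine mul_le_mul_of_nonneg_left ?_ (Nat.cast_nonneg k)
      refine le_trans (Finset.sum_le_sum fun l _ => ?_) (hsum (fun j => z j.succ) fun j i => hz _ i)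
      refine pow_le_pow_left₀ (norm_nonneg _) ?_ 2
      rw [norm_mul]
      exact mul_le_of_le_one_left (norm_nonneg _) (hz 0 l)

theorem exists_multilinear_norm_sq_le (k : ℕ) [NeZero k] (m : ℕ) :
    ∃ c : (Fin m → ZMod k) → ℂ, (∀ g, ‖c g‖ = 1) ∧
      ∀ z : Fin m → ZMod k → ℂ, (∀ j i, ‖z j i‖ ≤ 1) →
        ‖∑ g, c g * ∏ j, z j (g j)‖ ^ 2 ≤ (k : ℝ) ^ (m + 1) := by
  obtain ⟨c, hc, h⟩ := exists_multilinear_sum_norm_sq_le k m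
  exact ⟨c 0, hc 0, fun z hz => (Finset.single_le_sum
    (f := fun i => ‖∑ g, c i g * ∏ j, z j (g j)‖ ^ 2) (fun _ _ => by positivity)
    (Finset.mem_univ 0)).trans (h z hz)⟩

/-! ### Blocks of Dirichlet polynomials built on large primes -/

theorem eventually_mul_rpow_le_primeCounting {α : ℝ} (hα : α < 1) (A : ℝ) :
    ∀ᶠ n : ℕ in atTop, A * (n : ℝ) ^ α ≤ Nat.primeCounting n := by
  have h1 : ∀ᶠ x : ℝ in atTop, ‖Real.log x‖ ≤ 1 / (4 * (|A| + 1)) * ‖x ^ (1 - α)‖ :=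
    (isLittleO_log_rpow_atTop (by linarith)).def (by positivity)
  have h2 : ∀ᶠ x : ℝ in atTop, ‖Real.log x‖ ≤ 1 / 8 * ‖x‖ :=
    Real.isLittleO_log_id_atTop.def (by norm_num)
  have hcast := tendsto_natCast_atTop_atTop (R := ℝ)
  filter_upwards [hcast.eventually h1, (hcast.comp (tendsto_add_atTop_nat 1)).eventually h2,
    eventually_ge_atTop 2] with n hn1 hn2 hn
  have hnR : (2 : ℝ) ≤ n := by exact_mod_cast hn
  have hlog : 0 < Real.log n := Real.log_pos (by linarith)
  refine le_trans ?_ (Chebyshev.pi_ge n)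
  rw [le_div_iff₀ hlog]
  simp only [Function.comp_apply, Nat.cast_add, Nat.cast_one] at hn2
  have e2 : Real.log (n + 1) ≤ n / 4 := by
    have := (le_abs_self _).trans hn2
    rw [Real.norm_of_nonneg (by linarith)] at this
    linarith
  have hpos : (0 : ℝ) < (n : ℝ) ^ α := Real.rpow_pos_of_pos (by linarith) _
  have e1 : A * (n : ℝ) ^ α * Real.log n ≤ n / 4 := by
    have h3 := (le_abs_self _).trans hn1
    rw [Real.norm_of_nonneg (by positivity)] at h3
    have h4 : A * (n : ℝ) ^ α * Real.log n ≤ (|A| + 1) * (n : ℝ) ^ α * Real.log n := by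
      gcongr
      linarith [le_abs_self A]
    have h5 : (n : ℝ) ^ α * (n : ℝ) ^ (1 - α) = n := by
      rw [← Real.rpow_add (by linarith)]; simp
    calc A * (n : ℝ) ^ α * Real.log n ≤ (|A| + 1) * (n : ℝ) ^ α * Real.log n := h4
      _ ≤ (|A| + 1) * (n : ℝ) ^ α * (1 / (4 * (|A| + 1)) * (n : ℝ) ^ (1 - α)) := by gcongr
      _ = ((n : ℝ) ^ α * (n : ℝ) ^ (1 - α)) / 4 := by field_simp
      _ = n / 4 := by rw [h5]
  have := Real.log_two_gt_d9
  nlinarith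

theorem exists_injective_primes {ι : Type*} [Fintype ι] {y X : ℕ}
    (h : Fintype.card ι + y ≤ Nat.primeCounting X) :
    ∃ p : ι → ℕ, Function.Injective p ∧ ∀ i, (p i).Prime ∧ y < p i ∧ p i ≤ X := by
  classical
  have h1 : Fintype.card ι ≤ Fintype.card ↥((Finset.Ioc y X).filter Nat.Prime) := by
    rw [Fintype.card_coe]
    have h2 : Nat.primeCounting X ≤ y + ((Finset.Ioc y X).filter Nat.Prime).card := by
      rw [Nat.primeCounting, Nat.primeCounting', Nat.count_eq_card_filter_range]
      refine (Finset.card_le_card (t := Finset.Icc 1 y ∪ (Finset.Ioc y X).filter Nat.Prime)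
        fun q hq => ?_).trans ((Finset.card_union_le _ _).trans_eq (by simp))
      simp only [Finset.mem_filter, Finset.mem_range, Finset.mem_union, Finset.mem_Icc,
        Finset.mem_Ioc] at hq ⊢
      have := hq.2.one_lt
      by_cases hqy : q ≤ y
      · left; omega
      · right; exact ⟨⟨by omega, by omega⟩, hq.2⟩
    omega
  obtain ⟨e⟩ := Function.Embedding.nonempty_of_card_le h1
  refine ⟨fun i => (e i : ℕ), Subtype.val_injective.comp e.injective, fun i => ?_⟩
  have := (e i).2
  simp only [Finset.mem_filter, Finset.mem_Ioc] at this
  exact ⟨this.2, this.1.1, this.1.2⟩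

theorem natCast_prod_cpow {ι : Type*} (F : Finset ι) (f : ι → ℕ) (w : ℂ) :
    ((∏ i ∈ F, f i : ℕ) : ℂ) ^ w = ∏ i ∈ F, (f i : ℂ) ^ w := by
  classical
  induction F using Finset.induction_on with
  | empty => simp
  | insert i F hi ih =>
    rw [Finset.prod_insert hi, Finset.prod_insert hi, Nat.cast_mul,
      Complex.natCast_mul_natCast_cpow, ih]

theorem exists_eq_natCast_cpow (n : ℕ) :
    ∃ e : algebraA, 1 ≤ n → ∀ s : rightHalfPlane,
      (e : rightHalfPlane →ᵇ ℂ) s = (n : ℂ) ^ (-(s : ℂ)) := by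
  rcases Nat.eq_zero_or_pos n with rfl | hn
  · exact ⟨0, fun h => by omega⟩
  have hn0 : (n : ℂ) ≠ 0 := Nat.cast_ne_zero.2 (by omega)
  have hc : Continuous fun s : rightHalfPlane => (n : ℂ) ^ (-(s : ℂ)) :=
    (continuous_subtype_val.neg).const_cpow (Or.inl hn0)
  have hb : ∀ s : rightHalfPlane, ‖(n : ℂ) ^ (-(s : ℂ))‖ ≤ 1 := fun s => by
    rw [Complex.norm_natCast_cpow_of_pos hn]
    have hs : 0 < (s : ℂ).re := s.2
    exact Real.rpow_le_one_of_one_le_of_nonpos (by exact_mod_cast hn) (by simpa using hs.le)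
  refine ⟨⟨BoundedContinuousFunction.ofNormedAddCommGroup _ hc 1 hb,
    dirichletPolynomials.le_topologicalClosure ?_⟩, fun _ s => rfl⟩
  refine ⟨Pi.single n 1, n, fun s => ?_⟩
  rw [dirichletPartialSum, Finset.sum_eq_single_of_mem n (Finset.mem_Icc.2 ⟨hn, le_rfl⟩)]
  · simp
  · intro b _ hb; simp [hb]

/-- The function `s ↦ n ^ (-s)` as an element of `𝒜(ℂ₀)`, with an unspecified value at `n = 0`. -/
noncomputable def dirichletMonomial (n : ℕ) : algebraA := (exists_eq_natCast_cpow n).choose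

theorem dirichletMonomial_apply {n : ℕ} (hn : 1 ≤ n) (s : rightHalfPlane) :
    (dirichletMonomial n : rightHalfPlane →ᵇ ℂ) s = (n : ℂ) ^ (-(s : ℂ)) :=
  (exists_eq_natCast_cpow n).choose_spec hn s

theorem dirichletCoeff_dirichletMonomial {n : ℕ} (hn : 1 ≤ n) (k : ℕ) :
    dirichletCoeff (dirichletMonomial n) k = if n = k then 1 else 0 := by
  rw [dirichletCoeff_of_eq_dirichletPartialSum (a := Pi.single n 1) (N := n)]
  · by_cases h : n = k
    · subst h; simp; omega
    · rw [Pi.single_eq_of_ne (Ne.symm h)]; simp [h]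
  · intro s
    rw [dirichletMonomial_apply hn, dirichletPartialSum,
      Finset.sum_eq_single_of_mem n (Finset.mem_Icc.2 ⟨hn, le_rfl⟩)]
    · simp
    · intro b _ hb; simp [hb]

/-- The Bohnenblust–Hille construction. With `m = 2r + 1` disjoint groups of `k` primes between `y`
and `X`, where `k ≥ X ^ α`, substitute `p ^ (-s)` for the variables of an `m`-linear form with
unimodular coefficients and norm at most `k ^ (r + 1)`. The `k ^ m` frequencies are at most `X ^ m`, so
after normalisation the weighted sum of the coefficients is at least
`k ^ r X ^ (-mσ) ≥ X ^ (rα - mσ)`. The frequencies form an antichain for divisibility. -/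
theorem exists_prime_block (σ : ℝ) (hσ : σ < 1 / 2) (y : ℕ) (C : ℝ) :
    ∃ (V : algebraA) (T : Finset ℕ), ‖V‖ ≤ 1 ∧ (∀ n, dirichletCoeff V n ≠ 0 → n ∈ T) ∧
      (∀ n ∈ T, 1 < n ∧ ∀ p, p.Prime → p ∣ n → y < p) ∧
      (∀ d ∈ T, ∀ n ∈ T, d ∣ n → d = n) ∧
      C ≤ ∑ n ∈ T, ‖dirichletCoeff V n‖ * (n : ℝ) ^ (-σ) := by
  classical
  wlog hσ0 : 0 ≤ σ generalizing σ
  · obtain ⟨V, T, h1, h2, h3, h4, h5⟩ := this 0 (by norm_num) le_rfl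
    refine ⟨V, T, h1, h2, h3, h4, h5.trans (Finset.sum_le_sum fun n hn => ?_)⟩
    refine mul_le_mul_of_nonneg_left ?_ (norm_nonneg _)
    exact Real.rpow_le_rpow_of_exponent_le (by exact_mod_cast (h3 n hn).1.le) (by linarith)
  -- `r` and `α` are such that `r α > (2 r + 1) σ`, which is possible because `σ < 1/2`
  obtain ⟨r, hr⟩ : ∃ r : ℕ, σ < r * (1 - 2 * σ) := by
    obtain ⟨r, hr⟩ := exists_nat_gt (σ / (1 - 2 * σ))
    exact ⟨r, (div_lt_iff₀ (by linarith)).1 hr⟩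
  have hr0 : (0 : ℝ) < r := by
    rcases Nat.eq_zero_or_pos r with rfl | h
    · simp at hr; linarith
    · exact_mod_cast h
  set m := 2 * r + 1 with hm
  obtain ⟨α, hα1, hα2⟩ : ∃ α : ℝ, m * σ / r < α ∧ α < 1 := by
    refine exists_between ((div_lt_one hr0).2 ?_)
    rw [hm]; push_cast; linarith
  have hα0 : 0 ≤ α := le_trans (by positivity) hα1.le
  have hexp : 0 < r * α - m * σ := by
    rw [div_lt_iff₀ hr0] at hα1; linarith
  have hev := eventually_mul_rpow_le_primeCounting hα2 (2 * m + y)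
  have hev2 := ((tendsto_rpow_atTop hexp).comp
    (tendsto_natCast_atTop_atTop (R := ℝ))).eventually_ge_atTop C
  obtain ⟨X, hX1, hX2, hX3⟩ := (hev.and (hev2.and (eventually_ge_atTop 1))).exists
  simp only [Function.comp_apply] at hX2
  have hXR : (1 : ℝ) ≤ X := by exact_mod_cast hX3
  have hXα : 1 ≤ (X : ℝ) ^ α := Real.one_le_rpow hXR hα0
  set k := ⌈(X : ℝ) ^ α⌉₊ with hk
  have hk1 : (X : ℝ) ^ α ≤ k := Nat.le_ceil _
  have hk2 : (k : ℝ) < (X : ℝ) ^ α + 1 := Nat.ceil_lt_add_one (by linarith)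
  have hkpos : (0 : ℝ) < k := by linarith
  have : NeZero k := ⟨by rintro h0; rw [h0] at hkpos; simp at hkpos⟩
  have hcard : Fintype.card (Fin m × ZMod k) + y ≤ Nat.primeCounting X := by
    rw [Fintype.card_prod, Fintype.card_fin, ZMod.card]
    have : ((m * k + y : ℕ) : ℝ) ≤ Nat.primeCounting X := by
      refine le_trans ?_ hX1
      push_cast
      have hm0 : (0 : ℝ) ≤ m := Nat.cast_nonneg _
      have hy0 : (0 : ℝ) ≤ y := Nat.cast_nonneg _
      nlinarith
    exact_mod_cast this
  obtain ⟨p, hpinj, hp⟩ := exists_injective_primes hcard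
  obtain ⟨c, hc, hbound⟩ := exists_multilinear_norm_sq_le k m
  let N : (Fin m → ZMod k) → ℕ := fun g => ∏ j, p (j, g j)
  have hNdvd : ∀ g h, N g ∣ N h → g = h := by
    intro g h hgh
    funext j
    have h1 : p (j, g j) ∣ N h :=
      (Finset.dvd_prod_of_mem (fun j => p (j, g j)) (Finset.mem_univ j)).trans hgh
    obtain ⟨j', -, h2⟩ := (hp _).1.prime.exists_mem_finset_dvd h1
    have h3 := hpinj ((Nat.prime_dvd_prime_iff_eq (hp _).1 (hp _).1).1 h2)
    rw [Prod.mk.injEq] at h3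
    obtain ⟨rfl, h4⟩ := h3
    exact h4
  have hNinj : Function.Injective N := fun g h hgh => hNdvd g h (dvd_of_eq hgh)
  have hNpos : ∀ g, 1 ≤ N g := fun g => Finset.prod_pos fun j _ => (hp _).1.pos
  have hN1 : ∀ g, 1 < N g := by
    intro g
    have h1 : p (0, g 0) ∣ N g := Finset.dvd_prod_of_mem (fun j => p (j, g j)) (Finset.mem_univ 0)
    exact (hp _).1.one_lt.trans_le (Nat.le_of_dvd (hNpos g) h1)
  have hNX : ∀ g, (N g : ℝ) ≤ (X : ℝ) ^ m := by
    intro g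
    have : N g ≤ ∏ _j : Fin m, X := Finset.prod_le_prod' fun j _ => (hp _).2.2
    rw [Finset.prod_const, Finset.card_univ, Fintype.card_fin] at this
    exact_mod_cast this
  let V₀ : algebraA := ∑ g, c g • dirichletMonomial (N g)
  have hV₀coeff : ∀ n, dirichletCoeff V₀ n = ∑ g, c g * if N g = n then 1 else 0 := by
    intro n
    rw [← dirichletCoeffCLM_apply, map_sum]
    refine Finset.sum_congr rfl fun g _ => ?_
    rw [map_smul, dirichletCoeffCLM_apply, dirichletCoeff_dirichletMonomial (hNpos g), smul_eq_mul]
  have hV₀N : ∀ g, dirichletCoeff V₀ (N g) = c g := by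
    intro g
    rw [hV₀coeff, Finset.sum_eq_single_of_mem g (Finset.mem_univ g)]
    · simp
    · intro h _ hh
      rw [if_neg fun e => hh (hNinj e), mul_zero]
  have hV₀norm : ‖V₀‖ ≤ (k : ℝ) ^ (r + 1) := by
    change ‖(V₀ : rightHalfPlane →ᵇ ℂ)‖ ≤ _
    refine (BoundedContinuousFunction.norm_le (by positivity)).2 fun s => ?_
    have hs : 0 < (s : ℂ).re := s.2
    have h1 : (V₀ : rightHalfPlane →ᵇ ℂ) s =
        ∑ g, c g * ∏ j, (fun j i => ((p (j, i) : ℂ)) ^ (-(s : ℂ))) j (g j) := by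
      simp only [V₀, AddSubmonoidClass.coe_finsetSum, BoundedContinuousFunction.coe_sum,
        Finset.sum_apply]
      refine Finset.sum_congr rfl fun g _ => ?_
      change c g • (dirichletMonomial (N g) : rightHalfPlane →ᵇ ℂ) s = _
      rw [dirichletMonomial_apply (hNpos g), smul_eq_mul, natCast_prod_cpow]
    have h2 := hbound (fun j i => ((p (j, i) : ℂ)) ^ (-(s : ℂ))) fun j i => by
      rw [Complex.norm_natCast_cpow_of_pos (hp _).1.pos]
      exact Real.rpow_le_one_of_one_le_of_nonpos (by exact_mod_cast (hp _).1.one_lt.le)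
        (by simpa using hs.le)
    rw [← h1, show m + 1 = (r + 1) * 2 by omega, pow_mul] at h2
    exact (sq_le_sq₀ (norm_nonneg _) (by positivity)).1 h2
  have hkr : (0 : ℝ) < (k : ℝ) ^ (r + 1) := by positivity
  have hcoeff : ∀ n, dirichletCoeff ((((k : ℝ) ^ (r + 1))⁻¹ : ℂ) • V₀) n =
      (((k : ℝ) ^ (r + 1))⁻¹ : ℂ) * dirichletCoeff V₀ n := fun n => by
    rw [← dirichletCoeffCLM_apply, map_smul]; rfl
  have hnormk : ‖(((k : ℝ) ^ (r + 1))⁻¹ : ℂ)‖ = ((k : ℝ) ^ (r + 1))⁻¹ := by simp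
  refine ⟨(((k : ℝ) ^ (r + 1))⁻¹ : ℂ) • V₀, Finset.univ.image N, ?_, ?_, ?_, ?_, ?_⟩
  · rw [norm_smul, hnormk, inv_mul_le_iff₀ hkr, mul_one]
    exact hV₀norm
  · intro n hn
    rw [hcoeff, hV₀coeff] at hn
    obtain ⟨g, -, hg⟩ := Finset.exists_ne_zero_of_sum_ne_zero (right_ne_zero_of_mul hn)
    refine Finset.mem_image.2 ⟨g, Finset.mem_univ g, ?_⟩
    by_contra h
    simp [h] at hg
  · intro n hn
    obtain ⟨g, -, rfl⟩ := Finset.mem_image.1 hn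
    refine ⟨hN1 g, fun q hq hqn => ?_⟩
    obtain ⟨j, -, hj⟩ := hq.prime.exists_mem_finset_dvd hqn
    rw [(Nat.prime_dvd_prime_iff_eq hq (hp _).1).1 hj]
    exact (hp _).2.1
  · intro d hd n hn hdn
    obtain ⟨g, -, rfl⟩ := Finset.mem_image.1 hd
    obtain ⟨h, -, rfl⟩ := Finset.mem_image.1 hn
    rw [hNdvd g h hdn]
  · rw [Finset.sum_image fun g _ h _ e => hNinj e]
    have hterm : ∀ g, ((k : ℝ) ^ (r + 1))⁻¹ * (X : ℝ) ^ (-(m * σ)) ≤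
        ‖dirichletCoeff ((((k : ℝ) ^ (r + 1))⁻¹ : ℂ) • V₀) (N g)‖ * (N g : ℝ) ^ (-σ) := by
      intro g
      rw [hcoeff, norm_mul, hnormk, hV₀N, hc, mul_one]
      refine mul_le_mul_of_nonneg_left ?_ (by positivity)
      rw [show -(m * σ) = (m : ℝ) * (-σ) by ring, Real.rpow_mul (by linarith), Real.rpow_natCast]
      exact Real.rpow_le_rpow_of_nonpos (by exact_mod_cast hNpos g) (hNX g) (by linarith)
    refine le_trans ?_ (Finset.sum_le_sum fun g _ => hterm g)
    rw [Finset.sum_const, Finset.card_univ, Fintype.card_fun, ZMod.card, Fintype.card_fin,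
      nsmul_eq_mul]
    calc C ≤ (X : ℝ) ^ (r * α - m * σ) := hX2
      _ = ((X : ℝ) ^ α) ^ r * (X : ℝ) ^ (-(m * σ)) := by
        rw [← Real.rpow_natCast, ← Real.rpow_mul (by linarith), ← Real.rpow_add (by linarith)]
        congr 1; ring
      _ ≤ (k : ℝ) ^ r * (X : ℝ) ^ (-(m * σ)) := by gcongr
      _ = ((k ^ m : ℕ) : ℝ) * (((k : ℝ) ^ (r + 1))⁻¹ * (X : ℝ) ^ (-(m * σ))) := by
        have : (k : ℝ) ^ m = (k : ℝ) ^ r * (k : ℝ) ^ (r + 1) := by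
          rw [← pow_add]; congr 1; omega
        push_cast
        rw [this]; field_simp

/-! ### Functions with isolated blocks -/

theorem dirichletCoeff_add_apply (f g : algebraA) (n : ℕ) :
    dirichletCoeff (f + g) n = dirichletCoeff f n + dirichletCoeff g n :=
  map_add (dirichletCoeffCLM n) f g

theorem dirichletCoeff_smul_apply (c : ℂ) (f : algebraA) (n : ℕ) :
    dirichletCoeff (c • f) n = c * dirichletCoeff f n :=
  map_smul (dirichletCoeffCLM n) c f

theorem isClosed_algebraA : IsClosed (algebraA : Set (rightHalfPlane →ᵇ ℂ)) :=
  dirichletPolynomials.isClosed_topologicalClosure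

/-- The exponents `1/2 - 1/(k+1)`, increasing to `1/2`. -/
noncomputable def exponentBelowHalf (k : ℕ) : ℝ := 1 / 2 - 1 / ((k : ℝ) + 1)

theorem exponentBelowHalf_lt (k : ℕ) : exponentBelowHalf k < 1 / 2 := by
  have : 0 < 1 / ((k : ℝ) + 1) := by positivity
  rw [exponentBelowHalf]; linarith

theorem le_exponentBelowHalf {σ : ℝ} (hσ : σ < 1 / 2) {k : ℕ} (hk : 1 / (1 / 2 - σ) ≤ k) :
    σ ≤ exponentBelowHalf k := by
  have h1 : 0 < 1 / 2 - σ := by linarith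
  have h3 : 1 / ((k : ℝ) + 1) ≤ 1 / 2 - σ := by
    rw [div_le_iff₀ h1] at hk
    rw [div_le_iff₀ (by positivity)]
    linarith
  rw [exponentBelowHalf]; linarith

/-- The functions are `W_i = ∑ 2^{-j} V_j`, where `j` runs over the codes of the pairs `(i, t)` and the
blocks `V_j` have mass `4 ^ j` and frequencies composed of primes in the disjoint intervals
`(Y j, Y (j + 1)]`. -/
theorem exists_hasIsolatedBlocks :
    ∃ W : ℕ → algebraA, HasIsolatedBlocks fun i => dirichletCoeff (W i) := by
  have : CompleteSpace algebraA := isClosed_algebraA.completeSpace_coe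
  choose V' T' hnorm hsupp hprime hanti hmass using
    fun (y j : ℕ) => exists_prime_block (exponentBelowHalf j) (exponentBelowHalf_lt j) y (4 ^ j)
  let Y : ℕ → ℕ := Nat.rec 0 fun j y => max (y + 1) ((T' y j).sup id)
  have hYsucc : ∀ j, Y (j + 1) = max (Y j + 1) ((T' (Y j) j).sup id) := fun j => rfl
  have hYmono : StrictMono Y := strictMono_nat_of_lt_succ fun j => by
    rw [hYsucc]; exact lt_of_lt_of_le (Nat.lt_succ_self _) (le_max_left _ _)
  let V : ℕ → algebraA := fun j => V' (Y j) j
  let T : ℕ → Finset ℕ := fun j => T' (Y j) j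
  have hTlt : ∀ j, ∀ n ∈ T j, ∀ p, p.Prime → p ∣ n → Y j < p ∧ p ≤ Y (j + 1) := by
    intro j n hn p hp hpn
    refine ⟨(hprime (Y j) j n hn).2 p hp hpn, ?_⟩
    rw [hYsucc]
    have h1 : n ≤ (T' (Y j) j).sup id := Finset.le_sup (f := id) hn
    have h2 : p ≤ n := Nat.le_of_dvd (by have := (hprime (Y j) j n hn).1; omega) hpn
    exact h2.trans (h1.trans (le_max_right _ _))
  have hblock : ∀ j j' p, Y j < p → p ≤ Y (j + 1) → Y j' < p → p ≤ Y (j' + 1) → j = j' := by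
    intro j j' p h1 h2 h3 h4
    have h5 : j < j' + 1 := hYmono.lt_iff_lt.1 (show Y j < Y (j' + 1) from h1.trans_le h4)
    have h6 : j' < j + 1 := hYmono.lt_iff_lt.1 (show Y j' < Y (j + 1) from h3.trans_le h2)
    omega
  let c : ℕ → ℕ → ℂ := fun i j => if (Nat.unpair j).1 = i then (1 / 2 : ℂ) ^ j else 0
  have hcnorm : ∀ i j, ‖c i j‖ ≤ (1 / 2 : ℝ) ^ j := by
    intro i j
    simp only [c]
    split_ifs
    · simp
    · simp
  have hsum : ∀ i, Summable fun j => c i j • V j := by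
    intro i
    refine Summable.of_norm_bounded (summable_geometric_two) fun j => ?_
    rw [norm_smul]
    exact (mul_le_of_le_one_right (norm_nonneg _) (hnorm _ _)).trans (hcnorm i j)
  let W : ℕ → algebraA := fun i => ∑' j, c i j • V j
  have hW : ∀ i n, HasSum (fun j => c i j * dirichletCoeff (V j) n) (dirichletCoeff (W i) n) := by
    intro i n
    have := (hsum i).hasSum.mapL (dirichletCoeffCLM n)
    simpa [map_smul] using this
  have hW0 : ∀ i n, dirichletCoeff (W i) n ≠ 0 → ∃ j, (Nat.unpair j).1 = i ∧ n ∈ T j := by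
    intro i n hn
    by_contra! h0
    refine hn ((hW i n).unique ?_)
    convert hasSum_zero using 2 with j
    by_cases hj : (Nat.unpair j).1 = i
    · have : dirichletCoeff (V j) n = 0 := by
        by_contra h1
        exact h0 j hj (hsupp _ _ _ h1)
      rw [this, mul_zero]
    · simp [c, hj]
  have hWT : ∀ i j, (Nat.unpair j).1 = i → ∀ n ∈ T j,
      dirichletCoeff (W i) n = (1 / 2 : ℂ) ^ j * dirichletCoeff (V j) n := by
    intro i j hj n hn
    have h1 := hasSum_single (f := fun j' => c i j' * dirichletCoeff (V j') n) j fun j' hj' => by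
      have : dirichletCoeff (V j') n = 0 := by
        by_contra h1
        have h2 : n ∈ T j' := hsupp _ _ _ h1
        obtain ⟨p, hp, hpn⟩ := Nat.exists_prime_and_dvd (hprime (Y j) j n hn).1.ne'
        obtain ⟨h3, h4⟩ := hTlt j n hn p hp hpn
        obtain ⟨h5, h6⟩ := hTlt j' n h2 p hp hpn
        exact hj' (hblock j' j p h5 h6 h3 h4)
      rw [this, mul_zero]
    rw [(hW i n).unique h1]
    simp [c, hj]
  refine ⟨W, fun i₀ L σ hσ C => ?_⟩
  obtain ⟨t, ht1, ht2⟩ : ∃ t : ℕ, C ≤ t ∧ 1 / (1 / 2 - σ) ≤ t ∧ L ≤ t := by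
    obtain ⟨t1, h1⟩ := exists_nat_ge C
    obtain ⟨t2, h2⟩ := exists_nat_ge (1 / (1 / 2 - σ))
    refine ⟨max t1 (max t2 L), h1.trans ?_, h2.trans ?_, ?_⟩
    · exact_mod_cast le_max_left _ _
    · exact_mod_cast (le_max_left _ _).trans (le_max_right _ _)
    · exact (le_max_right _ _).trans (le_max_right _ _)
  set j := Nat.pair i₀ t with hj
  have hji : (Nat.unpair j).1 = i₀ := by rw [hj, Nat.unpair_pair]
  have htj : t ≤ j := Nat.right_le_pair _ _
  have htjR : (t : ℝ) ≤ j := by exact_mod_cast htj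
  have hLY : L ≤ Y j := ht2.2.trans (htj.trans hYmono.le_apply)
  have hστ : σ ≤ exponentBelowHalf j := le_exponentBelowHalf hσ (ht2.1.trans htjR)
  refine ⟨T j, ?_, fun n hn => ⟨(hprime (Y j) j n hn).1, fun l hl => ?_, ?_⟩⟩
  · have h1 : C ≤ (1 / 2 : ℝ) ^ j * 4 ^ j := by
      rw [← mul_pow]
      have h2 : (j : ℝ) < 2 ^ j := by exact_mod_cast Nat.lt_two_pow_self
      norm_num
      linarith
    refine h1.trans ((mul_le_mul_of_nonneg_left (hmass (Y j) j) (by positivity)).trans ?_)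
    rw [Finset.mul_sum]
    refine Finset.sum_le_sum fun n hn => ?_
    rw [hWT i₀ j hji n hn, norm_mul, ← mul_assoc]
    have h3 : ‖(1 / 2 : ℂ) ^ j‖ = (1 / 2 : ℝ) ^ j := by simp
    rw [h3]
    refine mul_le_mul_of_nonneg_left ?_ (by positivity)
    exact Real.rpow_le_rpow_of_exponent_le
      (by exact_mod_cast (hprime (Y j) j n hn).1.le) (by linarith)
  · refine Nat.Coprime.symm (Nat.coprime_of_dvd fun p hp hpn hpl => ?_)
    have h1 := (hTlt j n hn p hp hpn).1
    have h2 := Finset.mem_Icc.1 hl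
    have h3 := Nat.le_of_dvd (by omega) hpl
    omega
  · intro i l hl d hd hd1 hne
    obtain ⟨j', hj', hmem⟩ := hW0 i _ hne
    have hl1 := Finset.mem_Icc.1 hl
    obtain ⟨p, hp, hpd⟩ := Nat.exists_prime_and_dvd hd1
    obtain ⟨h3, h4⟩ := hTlt j n hn p hp (hpd.trans hd)
    obtain ⟨h5, h6⟩ := hTlt j' _ hmem p hp (hpd.trans (Dvd.intro_left l rfl))
    have hjj : j' = j := hblock j' j p h5 h6 h3 h4
    rw [hjj] at hj' hmem
    have hl' : l = 1 := by
      by_contra hl'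
      obtain ⟨q, hq, hql⟩ := Nat.exists_prime_and_dvd hl'
      have h7 := (hTlt j _ hmem q hq (hql.trans (Dvd.intro d rfl))).1
      have h8 := Nat.le_of_dvd (by omega) hql
      omega
    refine ⟨by rw [← hj', hji], hl', ?_⟩
    rw [hl', one_mul] at hmem
    exact hanti (Y j) j d hmem n hn hd

/-! ### Freely generated algebras -/

theorem aeval_dirichletCoeff {ι : Type*} (D : ι → algebraA) (Q : MvPolynomial ι ℂ) :
    MvPolynomial.aeval (fun i => dirichletCoeff (D i)) Q =
      dirichletCoeff (MvPolynomial.aeval D Q) :=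
  (MvPolynomial.comp_aeval_apply (f := D) dirichletCoeffHom Q).symm

theorem NonUnitalAlgebra.exists_aeval_eq_of_mem_adjoin_range {ι A : Type*} [CommRing A]
    [Algebra ℂ A] {D : ι → A} {x : A} (hx : x ∈ NonUnitalAlgebra.adjoin ℂ (Set.range D)) :
    ∃ Q : MvPolynomial ι ℂ, Q.coeff 0 = 0 ∧ MvPolynomial.aeval D Q = x := by
  induction hx using NonUnitalAlgebra.adjoin_induction with
  | mem x hx =>
    obtain ⟨i, rfl⟩ := hx
    exact ⟨MvPolynomial.X i, by simp, by simp⟩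
  | zero => exact ⟨0, by simp, by simp⟩
  | add x y _ _ hx hy =>
    obtain ⟨P, hP, rfl⟩ := hx
    obtain ⟨Q, hQ, rfl⟩ := hy
    exact ⟨P + Q, by simp [hP, hQ], by simp⟩
  | mul x y _ _ hx hy =>
    obtain ⟨P, hP, rfl⟩ := hx
    obtain ⟨Q, hQ, rfl⟩ := hy
    refine ⟨P * Q, ?_, by simp⟩
    rw [← MvPolynomial.constantCoeff_eq] at *
    rw [map_mul, hP, zero_mul]
  | smul c x _ hx =>
    obtain ⟨P, hP, rfl⟩ := hx
    exact ⟨c • P, by simp [hP], by simp⟩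

theorem freelyGeneratesIn_range {ι : Type*} [Nonempty ι] {D : ι → algebraA}
    (h : ∀ Q : MvPolynomial ι ℂ, Q ≠ 0 → Q.coeff 0 = 0 →
      AbsDivergesBelowHalf (dirichletCoeff (MvPolynomial.aeval D Q))) :
    Function.Injective D ∧ FreelyGeneratesIn (Set.range D) maximalStrip := by
  have hind : AlgebraicIndependent ℂ D := by
    rw [algebraicIndependent_iff]
    intro Q hQ
    by_contra hQ0
    -- multiplying by a variable reduces to polynomials without constant term
    let i : ι := Classical.arbitrary ι
    have h1 : MvPolynomial.X i * Q ≠ 0 := mul_ne_zero (MvPolynomial.X_ne_zero i) hQ0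
    have h2 : (MvPolynomial.X i * Q).coeff 0 = 0 := by
      rw [← MvPolynomial.constantCoeff_eq]; simp
    refine (h _ h1 h2).ne_zero ?_
    rw [map_mul, hQ, mul_zero]
    exact map_zero dirichletCoeffHom
  refine ⟨hind.injective, hind.coe_range, fun x hx => ?_⟩
  obtain ⟨Q, hQ, rfl⟩ := NonUnitalAlgebra.exists_aeval_eq_of_mem_adjoin_range hx
  by_cases hQ0 : Q = 0
  · right; simp [hQ0]
  · left; exact (h Q hQ0 hQ).mem_maximalStrip

theorem HasIsolatedBlocks.absDivergesBelowHalf_aeval {ι : Type*} {D : ι → algebraA}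
    (h : HasIsolatedBlocks fun i => dirichletCoeff (D i)) {Q : MvPolynomial ι ℂ} (hQ : Q ≠ 0)
    (hQ0 : Q.coeff 0 = 0) : AbsDivergesBelowHalf (dirichletCoeff (MvPolynomial.aeval D Q)) := by
  obtain ⟨m, hm⟩ := MvPolynomial.ne_zero_iff.1 hQ
  rw [← aeval_dirichletCoeff]
  exact h.absDivergesBelowHalf (m := m) (by rintro rfl; exact hm hQ0) hm

theorem stronglyAlgebrable_maximalStrip : StronglyAlgebrable Cardinal.aleph0 maximalStrip := by
  obtain ⟨W, hW⟩ := exists_hasIsolatedBlocks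
  obtain ⟨hinj, hfree⟩ := freelyGeneratesIn_range fun Q hQ hQ0 =>
    hW.absDivergesBelowHalf_aeval hQ hQ0
  exact ⟨Set.range W, by rw [Cardinal.mk_range_eq W hinj, Cardinal.mk_nat], hfree⟩

/-- Isolated blocks survive scaling and the addition of a Dirichlet polynomial. -/
theorem HasIsolatedBlocks.add_smul {W P : algebraA}
    (h : HasIsolatedBlocks fun _ : Unit => dirichletCoeff W) {N : ℕ}
    (hP : ∀ n, N < n → dirichletCoeff P n = 0) {ε : ℂ} (hε : ε ≠ 0) :
    HasIsolatedBlocks fun _ : Unit => dirichletCoeff (P + ε • W) := by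
  intro i₀ L σ hσ C
  have hε' : 0 < ‖ε‖ := norm_pos_iff.2 hε
  obtain ⟨T, hC, hT⟩ := h i₀ (max 1 (max L N)) σ hσ (C / ‖ε‖)
  have hbig : ∀ n ∈ T, ∀ d, d ∣ n → d ≠ 1 → N < d := by
    intro n hn d hd hd1
    by_contra! hdN
    obtain ⟨hn1, hcop, -⟩ := hT n hn
    have hd0 : 0 < d := Nat.pos_of_dvd_of_pos hd (by omega)
    have h2 : d.Coprime n := hcop d (Finset.mem_Icc.2
      ⟨hd0, hdN.trans ((le_max_right _ _).trans (le_max_right _ _))⟩)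
    exact hd1 (h2.eq_one_of_dvd hd)
  have hcoeff : ∀ n, N < n → dirichletCoeff (P + ε • W) n = ε * dirichletCoeff W n := by
    intro n hn
    rw [dirichletCoeff_add_apply, dirichletCoeff_smul_apply, hP n hn, zero_add]
  have hL : ∀ l ∈ Finset.Icc 1 L, l ∈ Finset.Icc 1 (max 1 (max L N)) := fun l hl =>
    Finset.Icc_subset_Icc_right ((le_max_left _ _).trans (le_max_right _ _)) hl
  refine ⟨T, ?_, fun n hn => ⟨(hT n hn).1, fun l hl => (hT n hn).2.1 l (hL l hl), ?_⟩⟩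
  · rw [div_le_iff₀ hε', Finset.sum_mul] at hC
    refine hC.trans_eq (Finset.sum_congr rfl fun n hn => ?_)
    rw [hcoeff n (hbig n hn n dvd_rfl (hT n hn).1.ne'), norm_mul]
    ring
  · intro i l hl d hd hd1 hne
    have hd : N < l * d := (hbig n hn d hd hd1).trans_le
      (Nat.le_mul_of_pos_left d (Finset.mem_Icc.1 hl).1)
    rw [hcoeff _ hd] at hne
    exact (hT n hn).2.2 i l (hL l hl) d ‹_› hd1 (right_ne_zero_of_mul hne)

/-! ### Generic functions -/

theorem HasIsolatedBlocks.comp_injective {ι κ : Type*} {a : ι → ArithmeticFunction ℂ}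
    (h : HasIsolatedBlocks a) {f : κ → ι} (hf : Function.Injective f) :
    HasIsolatedBlocks (a ∘ f) := by
  intro i₀ L σ hσ C
  obtain ⟨T, hC, hT⟩ := h (f i₀) L σ hσ C
  refine ⟨T, hC, fun n hn => ⟨(hT n hn).1, (hT n hn).2.1, fun i l hl d hd hd1 hne => ?_⟩⟩
  obtain ⟨h1, h2⟩ := (hT n hn).2.2 (f i) l hl d hd hd1 hne
  exact ⟨hf h1, h2⟩

/-- The polynomial `∑_{i<d} q_i X^{i+1}`, evaluated at `D`. -/
noncomputable def evalPoly {d : ℕ} (q : Fin d → ℂ) (D : algebraA) : algebraA :=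
  ∑ i, q i • D ^ ((i : ℕ) + 1)

theorem evalPoly_smul {d : ℕ} (c : ℂ) (q : Fin d → ℂ) (D : algebraA) :
    evalPoly (c • q) D = c • evalPoly q D := by
  simp [evalPoly, Finset.smul_sum, smul_smul]

theorem coeff_sum_smul_X_pow {d : ℕ} (q : Fin d → ℂ) (k : ℕ) :
    MvPolynomial.coeff (Finsupp.single () k)
        (∑ i, q i • (MvPolynomial.X () : MvPolynomial Unit ℂ) ^ ((i : ℕ) + 1)) =
      ∑ i : Fin d, if (i : ℕ) + 1 = k then q i else 0 := by
  classical
  simp only [MvPolynomial.coeff_sum, MvPolynomial.coeff_smul, MvPolynomial.coeff_X_pow,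
    (Finsupp.single_injective ()).eq_iff, smul_eq_mul, mul_ite, mul_one, mul_zero]

theorem exists_evalPoly_eq_aeval {Q : MvPolynomial Unit ℂ} (hQ : Q ≠ 0) (hQ0 : Q.coeff 0 = 0) :
    ∃ (d : ℕ) (q : Fin d → ℂ), q ≠ 0 ∧
      ∀ D : algebraA, MvPolynomial.aeval (fun _ => D) Q = evalPoly q D := by
  let q : Fin Q.totalDegree → ℂ := fun i => Q.coeff (Finsupp.single () ((i : ℕ) + 1))
  have hQq : Q = ∑ i, q i • MvPolynomial.X () ^ ((i : ℕ) + 1) := by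
    ext m
    obtain ⟨k, rfl⟩ : ∃ k, m = Finsupp.single () k := ⟨m (), Finsupp.unique_ext (by simp)⟩
    rw [coeff_sum_smul_X_pow]
    rcases Nat.eq_zero_or_pos k with rfl | hk
    · simp [hQ0]
    obtain ⟨k, rfl⟩ : ∃ k', k = k' + 1 := ⟨k - 1, by omega⟩
    by_cases hkd : k < Q.totalDegree
    · rw [Finset.sum_eq_single_of_mem (⟨k, hkd⟩ : Fin Q.totalDegree) (Finset.mem_univ _)]
      · simp [q]
      · intro i _ hi
        rw [if_neg fun h => hi (Fin.ext (by simpa using h))]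
    · rw [Finset.sum_eq_zero fun i _ => if_neg fun h => hkd (by have := i.2; omega)]
      refine MvPolynomial.coeff_eq_zero_of_totalDegree_lt ?_
      rw [Finsupp.support_single _ (by omega), Finset.sum_singleton,
        Finsupp.single_eq_same]
      omega
  refine ⟨_, q, fun h0 => hQ ?_, fun D => ?_⟩
  · rw [hQq, h0]; simp
  · conv_lhs => rw [hQq]
    simp [evalPoly]

theorem HasIsolatedBlocks.absDivergesBelowHalf_evalPoly {D : algebraA}
    (h : HasIsolatedBlocks fun _ : Unit => dirichletCoeff D) {d : ℕ} {q : Fin d → ℂ} (hq : q ≠ 0) :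
    AbsDivergesBelowHalf (dirichletCoeff (evalPoly q D)) := by
  let Q : MvPolynomial Unit ℂ := ∑ i, q i • MvPolynomial.X () ^ ((i : ℕ) + 1)
  obtain ⟨i, hi⟩ := Function.ne_iff.1 hq
  have hQ : Q ≠ 0 := by
    refine MvPolynomial.ne_zero_iff.2 ⟨Finsupp.single () ((i : ℕ) + 1), ?_⟩
    rw [coeff_sum_smul_X_pow, Finset.sum_eq_single_of_mem i (Finset.mem_univ _)]
    · simpa using hi
    · intro j _ hj
      rw [if_neg fun h => hj (Fin.ext (by simpa using h))]
  have hQ0 : Q.coeff 0 = 0 := by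
    rw [← Finsupp.single_zero (), coeff_sum_smul_X_pow]; simp
  have := h.absDivergesBelowHalf_aeval (D := fun _ => D) hQ hQ0
  have hev : MvPolynomial.aeval (fun _ => D) Q = evalPoly q D := by simp [Q, evalPoly]
  rwa [hev] at this

/-- The functions `D` such that, for all `q` in the unit sphere of `ℂ^d`, the Dirichlet
coefficients `b_n` of `∑ q_i D^{i+1}` satisfy `∑ |b_n| n^{-σ} > k`, where `σ = 1/2 - 1/(k+1)`. -/
def largeOnSphere (d k : ℕ) : Set algebraA :=
  {D | ∀ q ∈ Metric.sphere (0 : Fin d → ℂ) 1, ∃ F : Finset ℕ,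
    (k : ℝ) < ∑ n ∈ F, ‖dirichletCoeff (evalPoly q D) n‖ * (n : ℝ) ^ (-exponentBelowHalf k)}

theorem isOpen_largeOnSphere (d k : ℕ) : IsOpen (largeOnSphere d k) := by
  rw [isOpen_iff_mem_nhds]
  intro D hD
  refine (isCompact_sphere (0 : Fin d → ℂ) 1).eventually_forall_of_forall_eventually
    fun q hq => ?_
  obtain ⟨F, hF⟩ := hD q hq
  have hc : Continuous fun z : algebraA × (Fin d → ℂ) => ∑ n ∈ F,
      ‖dirichletCoeffCLM n (evalPoly z.2 z.1)‖ * (n : ℝ) ^ (-exponentBelowHalf k) := by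
    unfold evalPoly
    fun_prop
  filter_upwards [(hc.tendsto (D, q)).eventually_const_lt hF] with z hz
  exact ⟨F, hz⟩

theorem absDivergesBelowHalf_evalPoly_of_mem {D : algebraA}
    (hD : ∀ d k, D ∈ largeOnSphere d k) {d : ℕ} {q : Fin d → ℂ} (hq : q ≠ 0) :
    AbsDivergesBelowHalf (dirichletCoeff (evalPoly q D)) := by
  intro σ hσ C
  have hq' : 0 < ‖q‖ := norm_pos_iff.2 hq
  obtain ⟨k₁, hk₁⟩ := exists_nat_ge (C / ‖q‖)
  obtain ⟨k₂, hk₂⟩ := exists_nat_ge (1 / (1 / 2 - σ))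
  have hk1 : C / ‖q‖ ≤ (max k₁ k₂ : ℕ) := hk₁.trans (by exact_mod_cast le_max_left _ _)
  have hk2 : 1 / (1 / 2 - σ) ≤ (max k₁ k₂ : ℕ) := hk₂.trans (by exact_mod_cast le_max_right _ _)
  obtain ⟨F, hF⟩ := hD d (max k₁ k₂) (((‖q‖ : ℂ))⁻¹ • q) (by
    rw [mem_sphere_zero_iff_norm, norm_smul, norm_inv, Complex.norm_real, norm_norm,
      inv_mul_cancel₀ hq'.ne'])
  refine ⟨F, ?_⟩
  have h1 := (hk1.trans_lt hF).le
  rw [div_le_iff₀ hq', Finset.sum_mul] at h1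
  refine h1.trans (Finset.sum_le_sum fun n _ => ?_)
  rw [evalPoly_smul, dirichletCoeff_smul_apply, norm_mul, norm_inv, Complex.norm_real, norm_norm]
  rcases Nat.eq_zero_or_pos n with rfl | hn
  · simp
  have h2 : (n : ℝ) ^ (-exponentBelowHalf (max k₁ k₂)) ≤ (n : ℝ) ^ (-σ) :=
    Real.rpow_le_rpow_of_exponent_le (by exact_mod_cast hn)
      (neg_le_neg (le_exponentBelowHalf hσ hk2))
  calc ‖q‖⁻¹ * ‖dirichletCoeff (evalPoly q D) n‖ * (n : ℝ) ^ (-exponentBelowHalf (max k₁ k₂)) * ‖q‖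
      = ‖dirichletCoeff (evalPoly q D) n‖ * (n : ℝ) ^ (-exponentBelowHalf (max k₁ k₂)) := by
        field_simp
    _ ≤ _ := mul_le_mul_of_nonneg_left h2 (norm_nonneg _)

theorem dense_iInter_largeOnSphere : Dense (⋂ d, ⋂ k, largeOnSphere d k) := by
  obtain ⟨W, hW⟩ := exists_hasIsolatedBlocks
  have hW0 : HasIsolatedBlocks fun _ : Unit => dirichletCoeff (W 0) :=
    hW.comp_injective (f := fun _ : Unit => 0) fun _ _ _ => rfl
  rw [Metric.dense_iff]
  intro D r hr
  obtain ⟨P, hP, hDP⟩ := Metric.mem_closure_iff.1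
    (show (D : rightHalfPlane →ᵇ ℂ) ∈ closure {g | IsDirichletPolynomial g} from D.2) (r / 2)
    (by linarith)
  let P' : algebraA := ⟨P, dirichletPolynomials.le_topologicalClosure hP⟩
  have hDP' : dist D P' < r / 2 := hDP
  obtain ⟨a, N, ha⟩ := hP
  have hPN : ∀ n, N < n → dirichletCoeff P' n = 0 := by
    intro n hn
    rw [dirichletCoeff_of_eq_dirichletPartialSum (f := P') ha, if_neg]
    simp only [Finset.mem_Icc]; omega
  have hε0 : 0 < r / (2 * (‖W 0‖ + 1)) := by positivity
  set ε : ℝ := r / (2 * (‖W 0‖ + 1)) with hε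
  have hblocks := hW0.add_smul hPN (ε := (ε : ℂ)) (by exact_mod_cast hε0.ne')
  refine ⟨P' + (ε : ℂ) • W 0, ?_, Set.mem_iInter₂.2 fun d k q hq => ?_⟩
  · rw [Metric.mem_ball, dist_comm]
    have h1 : dist P' (P' + (ε : ℂ) • W 0) < r / 2 := by
      rw [dist_self_add_right, norm_smul, Complex.norm_real, Real.norm_of_nonneg hε0.le, hε,
        div_mul_eq_mul_div, div_lt_iff₀ (by positivity)]
      nlinarith [norm_nonneg (W 0)]
    linarith [dist_triangle D P' (P' + (ε : ℂ) • W 0)]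
  · have hq0 : q ≠ 0 := by
      rintro rfl
      simp at hq
    obtain ⟨F, hF⟩ := hblocks.absDivergesBelowHalf_evalPoly hq0 (exponentBelowHalf k)
      (exponentBelowHalf_lt k) (k + 1)
    exact ⟨F, by linarith⟩

theorem theorem1p3 :
    StronglyAlgebrable Cardinal.aleph0 maximalStrip ∧
      ∃ G : Set algebraA, IsGδ G ∧ Dense G ∧
        ∀ D ∈ G, FreelyGeneratesIn {D} maximalStrip := by
  refine ⟨stronglyAlgebrable_maximalStrip, ⋂ d, ⋂ k, largeOnSphere d k,
    .iInter fun d => .iInter fun k => (isOpen_largeOnSphere d k).isGδ,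
    dense_iInter_largeOnSphere, fun D hD => ?_⟩
  have h := (freelyGeneratesIn_range (D := fun _ : Unit => D) fun Q hQ hQ0 => ?_).2
  · rwa [Set.range_const] at h
  · obtain ⟨d, q, hq, hev⟩ := exists_evalPoly_eq_aeval hQ hQ0
    rw [hev]
    exact absDivergesBelowHalf_evalPoly_of_mem (Set.mem_iInter₂.1 hD) hq
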